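/- Let $H_{\mathbb R}$ be a separable real Hilbert space with complexification $H$ (inner product linear on the right), let $x\mapsto\bar x$ be a self-adjoint ($\mathbb C$-linear) involution of $H$, and let $\alpha,q\in(-1,1)$. Let $\Sigma(n)$ be the hyperoctahedral group of bijections $\sigma$ of $\{\pm1,\dots,\pm n\}$ with $\sigma(-k)=-\sigma(k)$, generated by $\pi_0=(1,-1)$ and $\pi_i=(i,i+1)$, $1\le i\le n-1$, and let $l_1(\sigma)$ (resp. $l_2(\sigma)$) be the number of letters $\pi_0$ (resp. $\pi_i$, $i\ge1$) in a word of minimal length for $\sigma$. The group $\Sigma(n)$ acts on $H^{\otimes n}$: $\pi_i$ exchanges the $i$-th and $(i+1)$-th factors and $\pi_0$ replaces the first factor $x_1$ by $\overline{x_1}$. On the algebraic full Fock space $\mathcal F=\bigoplus_{n\ge0}H^{\otimes n}$ with vacuum $\Omega$ (the unit vector spanning $H^{\otimes 0}$) consider the inner product for which the $H^{\otimes n}$ are orthogonal and $$\langle f,g\rangle_{\alpha,q}=\Big\langle f,\ \sum_{\sigma\in\Sigma(n)}\alpha^{l_1(\sigma)}q^{l_2(\sigma)}\,\sigma g\Big\rangle_{0,0}\quad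 (f,g\in H^{\otimes n}),\qquad \langle x_1\otimes\cdots\otimes x_n,y_1\otimes\cdots\otimes y_n\rangle_{0,0}=\prod_{i=1}^n\langle x_i,y_i\rangle .$$ Let $b^*(x)$ be the operator $x_1\otimes\cdots\otimes x_n\mapsto x_1\otimes\cdots\otimes x_n\otimes x$, $\Omega\mapsto x$, let $b(x)=b^1(x)$ be its adjoint with respect to $\langle\cdot,\cdot\rangle_{\alpha,q}$, and let $G(x)=b(x)+b^*(x)$. Let $\mathcal P_2(n)$ be the set of partitions of $[n]=\{1,\dots,n\}$ all of whose blocks have two elements, and $\mathcal P^B_2(n)$ the set of pairs $(\pi,f)$ with $\pi\in\mathcal P_2(n)$ and $f:\pi\to\{\pm1\}$. For $\epsilon\in\{1,*\}^n$ let $\mathcal P_{2;\epsilon}(n)$ be the set of those $\pi\in\mathcal P_2(n)$ such that $\epsilon(a)=*$ and $\epsilon(b)=1$ for every block $\{a<b\}$ of $\pi$, and $\mathcal P^B_{2;\epsilon}(n)$ the set of $(\pi,f)\in\mathcal P^B_2(n)$ with $\pi\in\mathcal P_{2;\epsilon}(n)$. A block $W$ covers a block $V$ if there are $i,j\in W$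 with $i<k<j$ for all $k\in V$. Let $\mathrm{Cr}(\pi)$ be the number of unordered pairs of crossing blocks ($i<k<j<l$ with $i,j$ in one of them and $k,l$ in the other), $\mathrm{Cov}(V)$ the number of blocks of $\pi$ covering $V$, $\mathrm{NB}(\pi,f)$ the number of blocks with $f=-1$, and $\mathrm{InNB}(\pi,f)$ the number of pairs $(V,W)$ of blocks with $f(V)=-1$ and $W$ covering $V$. Let $n\ge0$ and $x_1,\dots,x_n\in H_{\mathbb R}$ be such that $\langle x_i,\overline{x_j}\rangle=\langle x_j,\overline{x_i}\rangle$ for all $i,j$ (this is automatic if the involution maps $H_{\mathbb R}$ into itself). Then, with empty sums equal to $0$: (1) For every $\epsilon\in\{1,*\}^n$, $$\langle\Omega,b^{\epsilon(n)}(x_n)\cdots b^{\epsilon(1)}(x_1)\Omega\rangle_{\alpha,q}=\sum_{(\pi,f)\in\mathcal P^B_{2;\epsilon}(n)}\alpha^{\mathrm{NB}(\pi,f)}q^{\mathrm{Cr}(\pi)+2\,\mathrm{InNB}(\pi,f)}\prod_{\{i,j\}\in\pi,\,f(\{i,j\})=1}\langle x_i,x_j\rangle\prod_{\{i,j\}\in\pi,\,f(\{i,j\})=-1}\langle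 x_i,\overline{x_j}\rangle$$ $$=\sum_{\pi\in\mathcal P_{2;\epsilon}(n)}q^{\mathrm{Cr}(\pi)}\prod_{\{i,j\}\in\pi}\big(\langle x_i,x_j\rangle+\alpha q^{2\mathrm{Cov}(\{i,j\})}\langle x_i,\overline{x_j}\rangle\big).$$ (2) $$\langle\Omega,G(x_n)\cdots G(x_1)\Omega\rangle_{\alpha,q}=\langle\Omega,G(x_1)\cdots G(x_n)\Omega\rangle_{\alpha,q}$$ $$=\sum_{(\pi,f)\in\mathcal P^B_2(n)}\alpha^{\mathrm{NB}(\pi,f)}q^{\mathrm{Cr}(\pi)+2\,\mathrm{InNB}(\pi,f)}\prod_{\{i,j\}\in\pi,\,f(\{i,j\})=1}\langle x_i,x_j\rangle\prod_{\{i,j\}\in\pi,\,f(\{i,j\})=-1}\langle x_i,\overline{x_j}\rangle$$ $$=\sum_{\pi\in\mathcal P_2(n)}q^{\mathrm{Cr}(\pi)}\prod_{\{i,j\}\in\pi}\big(\langle x_i,x_j\rangle+\alpha q^{2\mathrm{Cov}(\{i,j\})}\langle x_i,\overline{x_j}\rangle\big).$$ -/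

import Mathlib

open scoped TensorProduct DirectSum

noncomputable section

namespace TypeBFock

/-! ## The hyperoctahedral group -/

/-- The `2n` points `±1, …, ±n`: the pair `(k, s)` stands for the signed point `s · (k + 1)`. -/
abbrev SignedPoint (n : ℕ) : Type := Fin n × ℤˣ

/-- The map `k ↦ -k` on the signed points. -/
def negPerm (n : ℕ) : Equiv.Perm (SignedPoint n) where
  toFun p := (p.1, -p.2)
  invFun p := (p.1, -p.2)
  left_inv p := by simp
  right_inv p := by simp

/-- The Coxeter group `Σ(n)` of type B: the bijections `σ` of `{±1, …, ±n}` such that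
`σ(-k) = -σ(k)`, that is, those which commute with `k ↦ -k`. -/
abbrev SigmaB (n : ℕ) : Subgroup (Equiv.Perm (SignedPoint n)) :=
  Subgroup.centralizer {negPerm n}

theorem mem_sigmaB_iff {n : ℕ} (σ : Equiv.Perm (SignedPoint n)) :
    σ ∈ SigmaB n ↔ ∀ p : SignedPoint n, σ (p.1, -p.2) = ((σ p).1, -(σ p).2) := by
  rw [Subgroup.mem_centralizer_singleton_iff]
  constructor
  · intro h p
    exact (Equiv.ext_iff.1 h p : σ (negPerm n p) = negPerm n (σ p))
  · intro h
    ext1 p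
    exact h p

instance instFintypeSigmaB (n : ℕ) : Fintype (SigmaB n) := Fintype.ofFinite _

/-- The generators as permutations of the signed points: `π_0 = (1, -1)` exchanges `1` and `-1`,
and, for `1 ≤ i ≤ n - 1`, `π_i = (i, i + 1)` exchanges `i` with `i + 1` and `-i` with `-(i + 1)`. -/
def genPerm {n : ℕ} (i : Fin n) : Equiv.Perm (SignedPoint n) :=
  if (i : ℕ) = 0 then Equiv.swap (i, 1) (i, -1)
  else Equiv.prodCongr (Equiv.swap ⟨(i : ℕ) - 1, by omega⟩ i) (Equiv.refl ℤˣ)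

theorem genPerm_mem {n : ℕ} (i : Fin n) : genPerm i ∈ SigmaB n := by
  rw [mem_sigmaB_iff]
  rintro ⟨k, s⟩
  unfold genPerm
  split_ifs with h
  · by_cases hk : k = i
    · subst hk
      rcases Int.units_eq_one_or s with rfl | rfl <;> simp
    · rw [Equiv.swap_apply_of_ne_of_ne, Equiv.swap_apply_of_ne_of_ne] <;>
        simp [hk]
  · simp

/-- The generators `π_0, …, π_{n-1}` of `Σ(n)`. -/
def gen {n : ℕ} (i : Fin n) : SigmaB n := ⟨genPerm i, genPerm_mem i⟩

/-- `w` is an irreducible form of `σ`: a word `π_{i_1} ⋯ π_{i_k} = σ` of minimal length. -/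
def IsReducedWord {n : ℕ} (σ : SigmaB n) (w : List (Fin n)) : Prop :=
  (w.map gen).prod = σ ∧ ∀ v : List (Fin n), (v.map gen).prod = σ → w.length ≤ v.length

/-- `l₁(σ)`: the number of letters `π_0` in an irreducible form of `σ`. (All irreducible forms
give the same number, so the infimum is taken over a set with one element.) -/
def l₁ {n : ℕ} (σ : SigmaB n) : ℕ :=
  sInf {k | ∃ w, IsReducedWord σ w ∧ k = w.countP (fun i => decide ((i : ℕ) = 0))}

/-- `l₂(σ)`: the number of letters `π_i`, `1 ≤ i ≤ n - 1`, in an irreducible form of `σ`. (All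
irreducible forms give the same number, so the infimum is over a set with one element.) -/
def l₂ {n : ℕ} (σ : SigmaB n) : ℕ :=
  sInf {k | ∃ w, IsReducedWord σ w ∧ k = w.countP (fun i => decide ((i : ℕ) ≠ 0))}

theorem sigmaB_apply {n : ℕ} (σ : SigmaB n) (k : Fin n) (s : ℤˣ) :
    σ.1 (k, s) = ((σ.1 (k, 1)).1, s * (σ.1 (k, 1)).2) := by
  rcases Int.units_eq_one_or s with rfl | rfl
  · simp
  · have h := (mem_sigmaB_iff σ.1).1 σ.2 (k, 1)
    simpa using h

/-- The sign of `σ(k)`, for `k > 0`. -/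
def sgn {n : ℕ} (σ : SigmaB n) (k : Fin n) : ℤˣ := (σ.1 (k, 1)).2

/-- The permutation `k ↦ |σ(k)|` of `{1, …, n}`. -/
def absPerm {n : ℕ} (σ : SigmaB n) : Equiv.Perm (Fin n) where
  toFun k := (σ.1 (k, 1)).1
  invFun k := ((σ⁻¹).1 (k, 1)).1
  left_inv k := by
    have h := sigmaB_apply σ⁻¹ (σ.1 (k, 1)).1 (σ.1 (k, 1)).2
    have h2 : (σ⁻¹).1 (σ.1 (k, 1)) = (k, 1) := by simp
    rw [Prod.mk.eta, h2] at h
    exact (congrArg Prod.fst h).symm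
  right_inv k := by
    have h := sigmaB_apply σ ((σ⁻¹).1 (k, 1)).1 ((σ⁻¹).1 (k, 1)).2
    have h2 : σ.1 ((σ⁻¹).1 (k, 1)) = (k, 1) := by simp
    rw [Prod.mk.eta, h2] at h
    exact (congrArg Prod.fst h).symm

section Fock

variable {H : Type*} [NormedAddCommGroup H] [InnerProductSpace ℂ H]

/-! ## Real form and tensor powers -/

/-- `HR` is a real Hilbert space and `H` is its complexification: the inner product is real on
the closed real subspace `HR`, and every vector of `H` is `x + i y` with `x, y ∈ HR` (the sum is
then automatically direct). -/
structure IsComplexificationOf (HR : Submodule ℝ H) : Prop where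
  isClosed : IsClosed (HR : Set H)
  inner_im : ∀ x ∈ HR, ∀ y ∈ HR, (inner ℂ x y).im = 0
  exists_add : ∀ z : H, ∃ x ∈ HR, ∃ y ∈ HR, z = x + Complex.I • y

/-- The action of `σ ∈ Σ(n)` on `H^{⊗n}`, with `J` the involution `x ↦ x̄`:
the `|σ(k)|`-th factor of `σ(x_1 ⊗ ⋯ ⊗ x_n)` is `x_k` if `σ(k) > 0`, and `x̄_k` if `σ(k) < 0`. -/
def act (J : H →ₗ[ℂ] H) {n : ℕ} (σ : SigmaB n) : Module.End ℂ (⨂[ℂ]^n H) :=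
  (PiTensorProduct.reindex ℂ (fun _ : Fin n => H) (absPerm σ)).toLinearMap ∘ₗ
    PiTensorProduct.map (fun k => if sgn σ k = 1 then LinearMap.id else J)

theorem act_tprod (J : H →ₗ[ℂ] H) {n : ℕ} (σ : SigmaB n) (x : Fin n → H) :
    act J σ (PiTensorProduct.tprod ℂ x) = PiTensorProduct.tprod ℂ (fun m =>
      if sgn σ ((absPerm σ).symm m) = 1 then x ((absPerm σ).symm m)
      else J (x ((absPerm σ).symm m))) := by
  unfold act
  rw [LinearMap.comp_apply, PiTensorProduct.map_tprod, LinearEquiv.coe_coe,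
    PiTensorProduct.reindex_tprod]
  congr 1
  ext m
  split_ifs <;> rfl

/-- If `J` is an involution, this is a left action of the group `Σ(n)`. -/
theorem act_mul (J : H →ₗ[ℂ] H) (hJ : ∀ x, J (J x) = x) {n : ℕ} (σ τ : SigmaB n) :
    act J (σ * τ) = act J σ * act J τ := by
  have h1 : ∀ k, absPerm (σ * τ) k = absPerm σ (absPerm τ k) := by
    intro k
    change (σ.1 (τ.1 (k, 1))).1 = (σ.1 ((τ.1 (k, 1)).1, 1)).1
    rw [← Prod.mk.eta (p := τ.1 (k, 1)), sigmaB_apply]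
  have h2 : ∀ k, sgn (σ * τ) k = sgn τ k * sgn σ (absPerm τ k) := by
    intro k
    change (σ.1 (τ.1 (k, 1))).2 = (τ.1 (k, 1)).2 * (σ.1 ((τ.1 (k, 1)).1, 1)).2
    conv_lhs => rw [← Prod.mk.eta (p := τ.1 (k, 1)), sigmaB_apply]
  apply PiTensorProduct.ext
  ext x
  simp only [LinearMap.compMultilinearMap_apply, Module.End.mul_apply, act_tprod]
  congr 1
  ext m
  obtain ⟨k, rfl⟩ := (absPerm (σ * τ)).surjective m
  rw [Equiv.symm_apply_apply, h1, Equiv.symm_apply_apply, Equiv.symm_apply_apply, h2]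
  rcases Int.units_eq_one_or (sgn σ (absPerm τ k)) with h | h <;>
    rcases Int.units_eq_one_or (sgn τ k) with h' | h' <;> simp [h, h', hJ]

/-- `π_0(x_1 ⊗ ⋯ ⊗ x_n) = x̄_1 ⊗ x_2 ⊗ ⋯ ⊗ x_n`. -/
theorem act_gen_zero (J : H →ₗ[ℂ] H) {n : ℕ} (i : Fin n) (hi : (i : ℕ) = 0) (x : Fin n → H) :
    act J (gen i) (PiTensorProduct.tprod ℂ x) =
      PiTensorProduct.tprod ℂ (Function.update x i (J (x i))) := by
  have h1 : absPerm (gen i) = Equiv.refl _ := by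
    ext k
    by_cases hk : k = i
    · subst hk; simp [absPerm, gen, genPerm, hi]
    · simp [absPerm, gen, genPerm, hi, Equiv.swap_apply_of_ne_of_ne, hk]
  rw [act_tprod, h1]
  congr 1
  ext k
  by_cases hk : k = i
  · subst hk; simp [sgn, gen, genPerm, hi]
  · simp [sgn, gen, genPerm, hi, Equiv.swap_apply_of_ne_of_ne, hk]

/-- `π_i` exchanges the factors `x_i` and `x_{i+1}` of `x_1 ⊗ ⋯ ⊗ x_n`. -/
theorem act_gen_pos (J : H →ₗ[ℂ] H) {n : ℕ} (i : Fin n) (hi : (i : ℕ) ≠ 0) (x : Fin n → H) :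
    act J (gen i) (PiTensorProduct.tprod ℂ x) =
      PiTensorProduct.tprod ℂ (x ∘ Equiv.swap ⟨(i : ℕ) - 1, by omega⟩ i) := by
  have h1 : absPerm (gen i) = Equiv.swap ⟨(i : ℕ) - 1, by omega⟩ i := by
    ext k
    simp [absPerm, gen, genPerm, hi]
  rw [act_tprod, h1]
  congr 1
  ext k
  simp [sgn, gen, genPerm, hi]

/-- The type B symmetrization operator `P^{(n)} = ∑_{σ ∈ Σ(n)} α^{l₁(σ)} q^{l₂(σ)} σ` on
`H^{⊗n}` (the identity for `n = 0`, as `Σ(0)` is trivial). -/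
def symmetrization (α q : ℝ) (J : H →ₗ[ℂ] H) (n : ℕ) : Module.End ℂ (⨂[ℂ]^n H) :=
  ∑ σ : SigmaB n, ((α : ℂ) ^ l₁ σ * (q : ℂ) ^ l₂ σ) • act J σ

/-- The functional `x_1 ⊗ ⋯ ⊗ x_n ↦ ∏ ⟨y_i, x_i⟩` on `H^{⊗n}`. -/
def tensorInnerLeft {n : ℕ} (y : Fin n → H) : (⨂[ℂ]^n H) →ₗ[ℂ] ℂ :=
  PiTensorProduct.lift
    ((MultilinearMap.mkPiAlgebra ℂ (Fin n) ℂ).compLinearMap (fun i => innerₛₗ ℂ (y i)))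

theorem tensorInnerLeft_tprod {n : ℕ} (y x : Fin n → H) :
    tensorInnerLeft y (PiTensorProduct.tprod ℂ x) = ∏ i, inner ℂ (y i) (x i) := by
  simp [tensorInnerLeft]

theorem tensorInnerLeft_update {n : ℕ} [DecidableEq (Fin n)] (y : Fin n → H) (i : Fin n) (z : H)
    (x : Fin n → H) :
    tensorInnerLeft (Function.update y i z) (PiTensorProduct.tprod ℂ x) =
      inner ℂ z (x i) * ∏ j ∈ Finset.univ.erase i, inner ℂ (y j) (x j) := by
  rw [tensorInnerLeft_tprod, ← Finset.mul_prod_erase _ _ (Finset.mem_univ i)]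
  congr 1
  · simp
  · apply Finset.prod_congr rfl
    intro j hj
    rw [Function.update_of_ne (Finset.ne_of_mem_erase hj)]

/-- The inner product `⟨·,·⟩_{0,0}` of `H^{⊗n}`, as the map `y ↦ (x ↦ ⟨x, y⟩_{0,0})`, linear in
`y` and antilinear in `x`; see `tensorForm_tprod` for its values. -/
def tensorForm (n : ℕ) : (⨂[ℂ]^n H) →ₗ[ℂ] (⨂[ℂ]^n H) →ₗ⋆[ℂ] ℂ :=
  PiTensorProduct.lift
    { toFun := fun y =>
        { toFun := fun t => (starRingEnd ℂ) (tensorInnerLeft y t)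
          map_add' := fun s t => by simp
          map_smul' := fun c t => by simp }
      map_update_add' := by
        intro _ y i a b
        ext t
        induction t using PiTensorProduct.induction_on with
        | smul_tprod r x =>
          simp [tensorInnerLeft_update, add_mul, mul_add]
        | add s t hs ht => rw [map_add, map_add, hs, ht]
      map_update_smul' := by
        intro _ y i c a
        ext t
        induction t using PiTensorProduct.induction_on with
        | smul_tprod r x =>
          simp only [map_smul, LinearMap.coe_mk, AddHom.coe_mk, LinearMap.smul_apply, smul_eq_mul,
            tensorInnerLeft_update, inner_smul_left, map_mul, RingHomCompTriple.comp_apply,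
            RingHom.id_apply]
          ring
        | add s t hs ht => rw [map_add, map_add, hs, ht] }

theorem tensorForm_tprod {n : ℕ} (x y : Fin n → H) :
    tensorForm n (PiTensorProduct.tprod ℂ y) (PiTensorProduct.tprod ℂ x) =
      ∏ i, inner ℂ (x i) (y i) := by
  simp [tensorForm, tensorInnerLeft_tprod]

/-! ## The Fock space of type B -/

variable (H) in
/-- The algebraic full Fock space `⨁_{n ≥ 0} H^{⊗n}`. -/
abbrev Fock : Type _ := ⨁ n : ℕ, ⨂[ℂ]^n H

variable (H) in
/-- The vacuum vector `Ω`, the unit vector spanning `H^{⊗0}` (the empty tensor). -/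
def vacuum : Fock H := DirectSum.lof ℂ ℕ (fun n => ⨂[ℂ]^n H) 0 (PiTensorProduct.tprod ℂ Fin.elim0)

/-- The sesquilinear form `⟨·,·⟩_{α,q}` as the map `g ↦ (f ↦ ⟨f, g⟩_{α,q})`, linear in `g` and
antilinear in `f`. -/
def fockForm (α q : ℝ) (J : H →ₗ[ℂ] H) : Fock H →ₗ[ℂ] Fock H →ₗ⋆[ℂ] ℂ :=
  DirectSum.toModule ℂ ℕ (Fock H →ₗ⋆[ℂ] ℂ) (fun n =>
    (tensorForm n ∘ₗ symmetrization α q J n).compl₂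
      (DirectSum.component ℂ ℕ (fun n => ⨂[ℂ]^n H) n))

/-- The deformed inner product `⟨f, g⟩_{α,q}`: the spaces `H^{⊗n}` are mutually orthogonal, and
`⟨f, g⟩_{α,q} = ⟨f, P^{(n)} g⟩_{0,0}` on `H^{⊗n}`. It is antilinear in `f` and linear in `g`. -/
def fockInner (α q : ℝ) (J : H →ₗ[ℂ] H) (f g : Fock H) : ℂ := fockForm α q J g f

theorem fockInner_lof (α q : ℝ) (J : H →ₗ[ℂ] H) (f : Fock H) (n : ℕ) (t : ⨂[ℂ]^n H) :
    fockInner α q J f (DirectSum.lof ℂ ℕ (fun n => ⨂[ℂ]^n H) n t) =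
      tensorForm n (symmetrization α q J n t) (f n) := by
  simp only [fockInner, fockForm, DirectSum.toModule_lof]
  rfl

/-- The creation operator `b^*(x)` of type B, i.e. the free right creation operator:
`x_1 ⊗ ⋯ ⊗ x_n ↦ x_1 ⊗ ⋯ ⊗ x_n ⊗ x` and `Ω ↦ x`. -/
def creation (x : H) : Module.End ℂ (Fock H) :=
  DirectSum.toModule ℂ ℕ (Fock H) (fun n =>
    DirectSum.lof ℂ ℕ (fun n => ⨂[ℂ]^n H) (n + 1) ∘ₗ
      (PiTensorProduct.lift
        (PiTensorProduct.tprod ℂ (s := fun _ : Fin (n + 1) => H)).curryRight).flip x)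

theorem creation_tprod (x : H) {n : ℕ} (y : Fin n → H) :
    creation x (DirectSum.lof ℂ ℕ (fun n => ⨂[ℂ]^n H) n (PiTensorProduct.tprod ℂ y)) =
      DirectSum.lof ℂ ℕ (fun n => ⨂[ℂ]^n H) (n + 1)
        (PiTensorProduct.tprod ℂ (Fin.snoc y x : Fin (n + 1) → H)) := by
  simp only [creation, DirectSum.toModule_lof, LinearMap.comp_apply, LinearMap.flip_apply,
    PiTensorProduct.lift.tprod, MultilinearMap.curryRight_apply]

/-- `T` is an adjoint of `b^*(x)` with respect to `⟨·,·⟩_{α,q}`. -/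
def IsCreationAdjoint (α q : ℝ) (J : H →ₗ[ℂ] H) (x : H) (T : Module.End ℂ (Fock H)) : Prop :=
  ∀ f g : Fock H, fockInner α q J (creation x f) g = fockInner α q J f (T g)

open Classical in
/-- The annihilation operator `b(x)` of type B: the adjoint of `b^*(x)` with respect to
`⟨·,·⟩_{α,q}`. (For a self-adjoint involution `J` and `α, q ∈ (-1, 1)` it exists and is unique;
the value `0` where there is no adjoint is never used then.) -/
def annihilation (α q : ℝ) (J : H →ₗ[ℂ] H) (x : H) : Module.End ℂ (Fock H) :=
  if h : ∃ T, IsCreationAdjoint α q J x T then h.choose else 0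

/-- The Gaussian operator of type B, `G(x) = b(x) + b^*(x)`. -/
def gaussian (α q : ℝ) (J : H →ₗ[ℂ] H) (x : H) : Module.End ℂ (Fock H) :=
  annihilation α q J x + creation x

/-- The two exponents `1` and `*` in `b^{ε}(x)`. -/
inductive Exponent : Type
  | one
  | star

/-- `b^1(x) = b(x)` and `b^*(x)`. -/
def bOp (α q : ℝ) (J : H →ₗ[ℂ] H) : Exponent → H → Module.End ℂ (Fock H)
  | Exponent.one, x => annihilation α q J x
  | Exponent.star, x => creation x

end Fock

/-! ## Pair partitions of type B -/

/-- The set partitions of `[n]`. -/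
abbrev SetPartition (n : ℕ) : Type := Finpartition (Finset.univ : Finset (Fin n))

/-- The set partitions of `[n]` of type B: a set partition with a colouring of its blocks
by `±1`. -/
abbrev SetPartitionB (n : ℕ) : Type := Σ π : SetPartition n, (π.parts → ℤˣ)

/-- Every block is a pair. -/
def IsPairPartition {n : ℕ} (π : SetPartition n) : Prop := ∀ V ∈ π.parts, V.card = 2

/-- Each pair block `{a, b}` with `a < b` has `ε(a) = *` and `ε(b) = 1`. -/
def IsCompatible {n : ℕ} (ε : Fin n → Exponent) (π : SetPartition n) : Prop :=
  ∀ V ∈ π.parts, ∀ a ∈ V, ∀ b ∈ V, a < b → ε a = Exponent.star ∧ ε b = Exponent.one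

open Classical in
/-- The pair partitions `P_2(n)`; there are none if `n` is odd. -/
def pairPartitions (n : ℕ) : Finset (SetPartition n) :=
  Finset.univ.filter (fun π => IsPairPartition π)

open Classical in
/-- The pair partitions `P_{2;ε}(n)` compatible with `ε`. -/
def pairPartitionsComp {n : ℕ} (ε : Fin n → Exponent) : Finset (SetPartition n) :=
  Finset.univ.filter (fun π => IsPairPartition π ∧ IsCompatible ε π)

open Classical in
/-- The pair partitions `P^B_2(n)` of type B. -/
def pairPartitionsB (n : ℕ) : Finset (SetPartitionB n) :=
  Finset.univ.filter (fun p => IsPairPartition p.1)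

open Classical in
/-- The pair partitions `P^B_{2;ε}(n)` of type B compatible with `ε`. -/
def pairPartitionsBComp {n : ℕ} (ε : Fin n → Exponent) : Finset (SetPartitionB n) :=
  Finset.univ.filter (fun p => IsPairPartition p.1 ∧ IsCompatible ε p.1)

open Classical in
/-- `NB(π, f)`: the number of negative blocks. -/
def NB {n : ℕ} (p : SetPartitionB n) : ℕ :=
  (Finset.univ.filter (fun V : p.1.parts => p.2 V = -1)).card

open Classical in
/-- `Cr(π)`: the number of (unordered) pairs of blocks which cross. -/
def Cr {n : ℕ} (π : SetPartition n) : ℕ :=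
  ((π.parts.powersetCard 2).filter (fun S => ∃ V ∈ S, ∃ W ∈ S, V ≠ W ∧
    ∃ i ∈ V, ∃ j ∈ V, ∃ k ∈ W, ∃ l ∈ W, i < k ∧ k < j ∧ j < l)).card

/-- The block `W` covers the block `V`. -/
def Covers {n : ℕ} (W V : Finset (Fin n)) : Prop :=
  ∃ i ∈ W, ∃ j ∈ W, ∀ k ∈ V, i < k ∧ k < j

open Classical in
/-- `Cov(V)`: the number of blocks of `π` which cover `V`. -/
def Cov {n : ℕ} (π : SetPartition n) (V : Finset (Fin n)) : ℕ :=
  (π.parts.filter (fun W => Covers W V)).card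

open Classical in
/-- `InNB(π, f)`: the number of pairs `(V, W)` of a negative pair block and a block covering it. -/
def InNB {n : ℕ} (p : SetPartitionB n) : ℕ :=
  (Finset.univ.filter (fun VW : p.1.parts × p.1.parts =>
    VW.1.1.card = 2 ∧ p.2 VW.1 = -1 ∧ Covers VW.2.1 VW.1.1)).card

/-- For a pair block `V = {i, j}` with `i < j`, this is `c i j`. -/
def onPair {n : ℕ} (c : Fin n → Fin n → ℂ) (V : Finset (Fin n)) : ℂ :=
  ∏ ij ∈ (V ×ˢ V).filter (fun ij => ij.1 < ij.2), c ij.1 ij.2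

theorem onPair_pair {n : ℕ} (c : Fin n → Fin n → ℂ) {i j : Fin n} (h : i < j) :
    onPair c {i, j} = c i j := by
  have : (({i, j} : Finset (Fin n)) ×ˢ {i, j}).filter (fun ij => ij.1 < ij.2) = {(i, j)} := by
    ext ⟨a, b⟩
    simp only [Finset.mem_filter, Finset.mem_product, Finset.mem_insert, Finset.mem_singleton,
      Prod.mk.injEq]
    constructor
    · rintro ⟨⟨rfl | rfl, rfl | rfl⟩, hab⟩ <;> simp_all [lt_asymm h]
    · rintro ⟨rfl, rfl⟩
      exact ⟨⟨Or.inl rfl, Or.inr rfl⟩, h⟩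
  rw [onPair, this, Finset.prod_singleton]

section Weights

variable {H : Type*} [NormedAddCommGroup H] [InnerProductSpace ℂ H]

open Classical in
/-- The weight `α^{NB(π,f)} q^{Cr(π) + 2 InNB(π,f)}
∏_{{i,j} ∈ π, f = 1} ⟨x_i, x_j⟩ ∏_{{i,j} ∈ π, f = -1} ⟨x_i, x̄_j⟩` of a pair partition `(π, f)`
of type B. -/
def weightB (α q : ℝ) (J : H →ₗ[ℂ] H) {n : ℕ} (x : Fin n → H) (p : SetPartitionB n) : ℂ :=
  (α : ℂ) ^ NB p * (q : ℂ) ^ (Cr p.1 + 2 * InNB p) *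
    (∏ V ∈ Finset.univ.filter (fun V : p.1.parts => p.2 V = 1),
      onPair (fun i j => inner ℂ (x i) (x j)) V.1) *
    ∏ V ∈ Finset.univ.filter (fun V : p.1.parts => p.2 V = -1),
      onPair (fun i j => inner ℂ (x i) (J (x j))) V.1

/-- The weight `q^{Cr(π)} ∏_{{i,j} ∈ π} (⟨x_i, x_j⟩ + α q^{2 Cov({i,j})} ⟨x_i, x̄_j⟩)` of a pair
partition `π`. -/
def weight (α q : ℝ) (J : H →ₗ[ℂ] H) {n : ℕ} (x : Fin n → H) (π : SetPartition n) : ℂ :=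
  (q : ℂ) ^ Cr π * ∏ V ∈ π.parts,
    onPair (fun i j => inner ℂ (x i) (x j) +
      (α : ℂ) * (q : ℂ) ^ (2 * Cov π V) * inner ℂ (x i) (J (x j))) V

end Weights

end TypeBFock

end

namespace TypeBFock

/-! ## Signed permutations and their lengths -/

section Group

variable {n : ℕ}

/-! Length in `SigmaB n` splits into two statistics: `negCount` counts the negative values, and
`invCount` counts, over positions i < j, how many of σ(i) > σ(j) and -σ(i) > σ(j) hold. A letter π_0
can raise only the first and a letter π_i, i ≥ 1, only the second, each by at most one. Removing
descents produces a word attaining both bounds, so the statistics are `l₁` and `l₂`.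

Sorting Σ(m+1) by the position k that is sent to ± the last point (`extend`) peels one factor off
the symmetrized form (`symForm_snoc`). Hence an adjoint of b^*(x) is `contractOp`: it removes the
factor y_k, k = 0, …, m, with coefficient q^(m-k) (⟨x, y_k⟩ + α q^(2k) ⟨x, ȳ_k⟩).

Let a word act letter by letter on the vacuum. The tensor factors present are the points opened but
not yet closed, in increasing order. A creation at T opens T; an annihilation at T closes some y_k.
The m-k open points after y_k lie in pairs that will cross {y_k, T}, and the k points before it lie
in pairs that will cover it. The exponents of q therefore build up `Cr` and `Cov`, and the recursion
`sum_openPairings` for pairings matches the one for operators; this is `fockInner_wick`. Expanding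
the product over the blocks as a sum over colourings gives the type B sums.

The operator `annihilation` is only some chosen adjoint. Nondegeneracy of the form is not needed:
two adjoints differ by vectors in the radical, which all the operators involved preserve, so vacuum
expectations can be computed with `contractOp`. The opposite order of the Gaussian word follows from
symmetry of G and the reality of the weights. -/

theorem sigmaB_ext {σ τ : SigmaB n} (h : ∀ k, absPerm σ k = absPerm τ k)
    (h' : ∀ k, sgn σ k = sgn τ k) : σ = τ := by
  apply Subtype.ext
  ext1 ⟨k, s⟩
  rw [sigmaB_apply, sigmaB_apply τ]
  exact Prod.ext (h k) (congrArg (s * ·) (h' k))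

theorem absPerm_mul (σ τ : SigmaB n) (k : Fin n) :
    absPerm (σ * τ) k = absPerm σ (absPerm τ k) := by
  change (σ.1 (τ.1 (k, 1))).1 = (σ.1 ((τ.1 (k, 1)).1, 1)).1
  rw [← Prod.mk.eta (p := τ.1 (k, 1)), sigmaB_apply]

theorem sgn_mul (σ τ : SigmaB n) (k : Fin n) :
    sgn (σ * τ) k = sgn τ k * sgn σ (absPerm τ k) := by
  change (σ.1 (τ.1 (k, 1))).2 = (τ.1 (k, 1)).2 * (σ.1 ((τ.1 (k, 1)).1, 1)).2
  conv_lhs => rw [← Prod.mk.eta (p := τ.1 (k, 1)), sigmaB_apply]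

@[simp] theorem absPerm_one (k : Fin n) : absPerm (1 : SigmaB n) k = k := rfl

@[simp] theorem sgn_one (k : Fin n) : sgn (1 : SigmaB n) k = 1 := rfl

theorem absPerm_inv_apply (σ : SigmaB n) (k : Fin n) : absPerm σ⁻¹ (absPerm σ k) = k := by
  rw [← absPerm_mul, inv_mul_cancel, absPerm_one]

theorem sgn_inv_apply (σ : SigmaB n) (k : Fin n) : sgn σ⁻¹ (absPerm σ k) = sgn σ k := by
  have h := sgn_mul σ⁻¹ σ k
  rw [inv_mul_cancel, sgn_one] at h
  rcases Int.units_eq_one_or (sgn σ k) with h1 | h1 <;> rw [h1] at h ⊢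
  · simpa using h.symm
  · rw [neg_one_mul] at h
    rw [h, neg_neg]

/-- The signed permutation `k ↦ s(k) · p(k)`. -/
def ofPermSign (p : Equiv.Perm (Fin n)) (s : Fin n → ℤˣ) : SigmaB n :=
  ⟨{ toFun := fun a => (p a.1, a.2 * s a.1)
     invFun := fun a => (p.symm a.1, a.2 * s (p.symm a.1))
     left_inv := fun a => by simp [mul_assoc]
     right_inv := fun a => by simp [mul_assoc] },
   (mem_sigmaB_iff _).2 fun a => by simp⟩

@[simp] theorem absPerm_ofPermSign (p : Equiv.Perm (Fin n)) (s : Fin n → ℤˣ) :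
    absPerm (ofPermSign p s) = p := by
  ext k; rfl

@[simp] theorem sgn_ofPermSign (p : Equiv.Perm (Fin n)) (s : Fin n → ℤˣ) (k : Fin n) :
    sgn (ofPermSign p s) k = s k := by
  simp [sgn, ofPermSign]

/-- A signed permutation is a permutation with a choice of signs. -/
def sigmaEquiv (n : ℕ) : SigmaB n ≃ Equiv.Perm (Fin n) × (Fin n → ℤˣ) where
  toFun σ := (absPerm σ, sgn σ)
  invFun a := ofPermSign a.1 a.2
  left_inv σ := sigmaB_ext (by simp) (by simp)
  right_inv a := Prod.ext (by simp) (by ext; simp)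

theorem card_sigmaB (n : ℕ) : Fintype.card (SigmaB n) = n.factorial * 2 ^ n := by
  rw [Fintype.card_congr (sigmaEquiv n)]
  simp [Fintype.card_perm]

/-! ### Behaviour of the generators -/

theorem absPerm_gen_zero (i : Fin n) (hi : (i : ℕ) = 0) (k : Fin n) : absPerm (gen i) k = k := by
  by_cases hk : k = i
  · subst hk; simp [absPerm, gen, genPerm, hi]
  · simp [absPerm, gen, genPerm, hi, Equiv.swap_apply_of_ne_of_ne, hk]

theorem sgn_gen_zero (i : Fin n) (hi : (i : ℕ) = 0) (k : Fin n) :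
    sgn (gen i) k = if k = i then -1 else 1 := by
  by_cases hk : k = i
  · subst hk; simp [sgn, gen, genPerm, hi]
  · simp [sgn, gen, genPerm, hi, Equiv.swap_apply_of_ne_of_ne, hk]

theorem absPerm_gen_pos (i : Fin n) (hi : (i : ℕ) ≠ 0) (k : Fin n) :
    absPerm (gen i) k = Equiv.swap ⟨(i : ℕ) - 1, by omega⟩ i k := by
  simp [absPerm, gen, genPerm, hi]

theorem sgn_gen_pos (i : Fin n) (hi : (i : ℕ) ≠ 0) (k : Fin n) : sgn (gen i) k = 1 := by
  simp [sgn, gen, genPerm, hi]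

theorem gen_mul_self (i : Fin n) : gen i * gen i = 1 := by
  by_cases hi : (i : ℕ) = 0
  · apply sigmaB_ext <;> intro k
    · simp [absPerm_mul, absPerm_gen_zero i hi]
    · rw [sgn_mul, absPerm_gen_zero i hi, sgn_gen_zero i hi]
      split_ifs <;> simp
  · apply sigmaB_ext <;> intro k
    · simp [absPerm_mul, absPerm_gen_pos i hi]
    · simp [sgn_mul, sgn_gen_pos i hi]

theorem gen_inv (i : Fin n) : (gen i)⁻¹ = gen i :=
  inv_eq_of_mul_eq_one_left (gen_mul_self i)

/-! ### Length statistics -/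

/-- The number of `k > 0` with `σ(k) < 0`. -/
def negCount (σ : SigmaB n) : ℕ := ∑ k, if sgn σ k = -1 then 1 else 0

/-- The number of type B inversions contributed by the positions `i < j`. -/
def invWeight (σ : SigmaB n) (i j : Fin n) : ℕ :=
  if absPerm σ j < absPerm σ i then 1 else if sgn σ j = -1 then 2 else 0

/-- The number of type B inversions, those of the form `σ(k) < 0` excepted. -/
def invCount (σ : SigmaB n) : ℕ := ∑ i, ∑ j, if i < j then invWeight σ i j else 0

theorem negCount_mul_gen_zero_of_neg (σ : SigmaB n) (i : Fin n) (hi : (i : ℕ) = 0)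
    (h : sgn σ i = -1) : negCount (σ * gen i) + 1 = negCount σ := by
  unfold negCount
  rw [← Finset.add_sum_erase _ _ (Finset.mem_univ i),
    ← Finset.add_sum_erase (a := i) _ (fun k => if sgn σ k = -1 then 1 else 0) (Finset.mem_univ i)]
  have : ∀ k ∈ Finset.univ.erase i, (if sgn (σ * gen i) k = -1 then 1 else 0) =
      if sgn σ k = -1 then 1 else 0 := by
    intro k hk
    rw [sgn_mul, sgn_gen_zero i hi, absPerm_gen_zero i hi, if_neg (Finset.ne_of_mem_erase hk),
      one_mul]
  rw [Finset.sum_congr rfl this]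
  simp [sgn_mul, sgn_gen_zero i hi, absPerm_gen_zero i hi, h]
  omega

theorem negCount_mul_gen_zero_le (σ : SigmaB n) (i : Fin n) (hi : (i : ℕ) = 0) :
    negCount (σ * gen i) ≤ negCount σ + 1 := by
  rcases Int.units_eq_one_or (sgn σ i) with h | h
  · have := negCount_mul_gen_zero_of_neg (σ * gen i) i hi
      (by simp [sgn_mul, sgn_gen_zero i hi, absPerm_gen_zero i hi, h])
    rw [mul_assoc, gen_mul_self, mul_one] at this
    omega
  · have := negCount_mul_gen_zero_of_neg σ i hi h
    omega

theorem negCount_mul_gen_pos (σ : SigmaB n) (i : Fin n) (hi : (i : ℕ) ≠ 0) :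
    negCount (σ * gen i) = negCount σ := by
  unfold negCount
  rw [← Equiv.sum_comp (absPerm (gen i)) (fun k => if sgn σ k = -1 then 1 else 0)]
  simp [sgn_mul, sgn_gen_pos i hi]

/-- Only the sign at the first position changes, and `invWeight` reads the sign at the larger of two
positions, which is never the first. -/
theorem invCount_mul_gen_zero (σ : SigmaB n) (i : Fin n) (hi : (i : ℕ) = 0) :
    invCount (σ * gen i) = invCount σ := by
  unfold invCount
  refine Finset.sum_congr rfl fun x _ => Finset.sum_congr rfl fun y _ => ?_
  split_ifs with h
  · have hy : y ≠ i := by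
      rintro rfl
      exact absurd h (by simp [Fin.lt_def, hi])
    simp [invWeight, absPerm_mul, sgn_mul, sgn_gen_zero i hi, absPerm_gen_zero i hi, hy]
  · rfl

/-- Exchanging adjacent positions preserves the order of every pair of positions except the pair a <
i itself. The identity is written additively to avoid subtraction in ℕ. -/
theorem invCount_mul_gen_pos (σ : SigmaB n) (i a : Fin n) (hi : (a : ℕ) + 1 = i) :
    invCount (σ * gen i) + invWeight σ a i = invCount σ + invWeight σ i a := by
  have ha : a = ⟨(i : ℕ) - 1, by omega⟩ := Fin.ext (by simp; omega)
  have hi0 : (i : ℕ) ≠ 0 := by omega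
  have hg : ∀ k, absPerm (gen i) k = Equiv.swap a i k := fun k => by
    rw [absPerm_gen_pos i hi0, ha]
  have h1 : invCount (σ * gen i) = ∑ x, ∑ y,
      if Equiv.swap a i x < Equiv.swap a i y then invWeight σ x y else 0 := by
    unfold invCount
    rw [← Equiv.sum_comp (Equiv.swap a i)
      (fun x => ∑ y, if Equiv.swap a i x < Equiv.swap a i y then invWeight σ x y else 0)]
    refine Finset.sum_congr rfl fun x _ => ?_
    rw [← Equiv.sum_comp (Equiv.swap a i) (fun y => if Equiv.swap a i (Equiv.swap a i x) <
      Equiv.swap a i y then invWeight σ (Equiv.swap a i x) y else 0)]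
    refine Finset.sum_congr rfl fun y _ => ?_
    simp [invWeight, absPerm_mul, sgn_mul, hg, sgn_gen_pos i hi0]
  have h2 : ∀ u v : Fin n, invWeight σ u v = ∑ x, ∑ y,
      if x = u ∧ y = v then invWeight σ x y else 0 := by
    intro u v
    rw [Finset.sum_eq_single u, Finset.sum_eq_single v] <;> simp +contextual
  rw [h1, h2 a i, h2 i a, invCount, ← Finset.sum_add_distrib, ← Finset.sum_add_distrib]
  refine Finset.sum_congr rfl fun x _ => ?_
  rw [← Finset.sum_add_distrib, ← Finset.sum_add_distrib]
  refine Finset.sum_congr rfl fun y _ => ?_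
  have hai : a < i := Fin.lt_def.2 (by omega)
  by_cases hx : x = a
  · subst hx
    by_cases hy : y = x
    · subst hy; simp [hai.ne]
    by_cases hy' : y = i
    · subst hy'; simp [hai, hai.ne, hai.le]
    · have : i < y ↔ x < y := by
        have := Fin.val_ne_of_ne hy; have := Fin.val_ne_of_ne hy'
        simp only [Fin.lt_def]; omega
      simp [Equiv.swap_apply_of_ne_of_ne, hy, hy', this]
  · by_cases hx' : x = i
    · subst hx'
      by_cases hy : y = x
      · subst hy; simp [hai.ne']
      by_cases hy' : y = a
      · subst hy'; simp [hai, hai.ne', hai.le]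
      · have : x < y ↔ a < y := by
          have := Fin.val_ne_of_ne hy; have := Fin.val_ne_of_ne hy'
          simp only [Fin.lt_def]; omega
        simp [Equiv.swap_apply_of_ne_of_ne, hy, hy', this]
    · by_cases hy : y = a
      · subst hy
        have : x < i ↔ x < y := by
          have := Fin.val_ne_of_ne hx; have := Fin.val_ne_of_ne hx'
          simp only [Fin.lt_def]; omega
        simp [Equiv.swap_apply_of_ne_of_ne, hx, hx', this]
      · by_cases hy' : y = i
        · subst hy'
          have : x < a ↔ x < y := by
            have := Fin.val_ne_of_ne hx; have := Fin.val_ne_of_ne hx'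
            simp only [Fin.lt_def]; omega
          simp [Equiv.swap_apply_of_ne_of_ne, hx, hx', this]
        · simp [Equiv.swap_apply_of_ne_of_ne, hx, hx', hy, hy']

/-- Of the two weights, the one whose first position has the larger absolute value is 1 and the
other is 0 or 2, so they differ by exactly one. -/
theorem invWeight_swap_le (σ : SigmaB n) {i a : Fin n} (h : i ≠ a) :
    invWeight σ i a ≤ invWeight σ a i + 1 := by
  have h' : absPerm σ i ≠ absPerm σ a := fun e => h ((absPerm σ).injective e)
  unfold invWeight
  rcases lt_or_gt_of_ne h' with h1 | h1
  · simp only [h1, h1.not_gt, if_true, if_false]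
    split_ifs <;> simp
  · simp only [h1, if_true]
    omega

theorem invCount_mul_gen_pos_le (σ : SigmaB n) (i : Fin n) (hi : (i : ℕ) ≠ 0) :
    invCount (σ * gen i) ≤ invCount σ + 1 := by
  have h := invCount_mul_gen_pos σ i ⟨(i : ℕ) - 1, by omega⟩ (by simp; omega)
  have h2 := invWeight_swap_le σ (i := i) (a := ⟨(i : ℕ) - 1, by omega⟩)
    (fun e => by have := congrArg Fin.val e; simp at this; omega)
  omega

@[simp] theorem negCount_one : negCount (1 : SigmaB n) = 0 := by
  simp [negCount]

@[simp] theorem invCount_one : invCount (1 : SigmaB n) = 0 := by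
  simp only [invCount, invWeight, absPerm_one, sgn_one]
  refine Finset.sum_eq_zero fun x _ => Finset.sum_eq_zero fun y _ => ?_
  by_cases h : x < y
  · simp [h, h.not_gt]
  · simp [h]

/-! ### Reduced words and the two statistics -/

theorem negCount_prod_le (w : List (Fin n)) :
    negCount (w.map gen).prod ≤ w.countP (fun i : Fin n => decide ((i : ℕ) = 0)) ∧
      invCount (w.map gen).prod ≤ w.countP (fun i : Fin n => decide ((i : ℕ) ≠ 0)) := by
  induction w using List.reverseRecOn with
  | nil => simp
  | append_singleton w i ih =>
    rw [List.map_append, List.prod_append, List.map_singleton, List.prod_singleton,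
      List.countP_append, List.countP_append]
    by_cases hi : (i : ℕ) = 0
    · have h1 := negCount_mul_gen_zero_le (w.map gen).prod i hi
      rw [invCount_mul_gen_zero _ i hi]
      simp only [List.countP_singleton, hi]
      simp
      exact ⟨by omega, by simpa using ih.2⟩
    · have h1 := invCount_mul_gen_pos_le (w.map gen).prod i hi
      rw [negCount_mul_gen_pos _ i hi]
      have h2 := ih.2
      have h3 : ((if decide ((i : ℕ) ≠ 0) = true then 1 else 0) : ℕ) = 1 := by simp [hi]
      rw [List.countP_singleton, List.countP_singleton, h3]
      exact ⟨ih.1.trans (Nat.le_add_right _ _), by omega⟩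

/-- A signed permutation without descents is the identity. -/
theorem eq_one_of_no_descent (σ : SigmaB n) (h0 : ∀ i : Fin n, (i : ℕ) = 0 → sgn σ i = 1)
    (h : ∀ a i : Fin n, (a : ℕ) + 1 = i → invWeight σ a i ≤ invWeight σ i a) : σ = 1 := by
  -- Without a descent, a positive sign passes to the next position and the absolute value grows
  -- there. Since the first sign is positive, `absPerm σ` is an increasing bijection, and `Fin n`
  -- has only one order automorphism.
  have step : ∀ a i : Fin n, (a : ℕ) + 1 = i → sgn σ a = 1 →
      sgn σ i = 1 ∧ absPerm σ a < absPerm σ i := by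
    intro a i hai ha
    have hne : absPerm σ a ≠ absPerm σ i := fun e => by
      have := (absPerm σ).injective e
      subst this; omega
    have h1 : (1 : ℤˣ) ≠ -1 := by decide
    have h2 := h a i hai
    rcases lt_or_gt_of_ne hne with h3 | h3
    · refine ⟨?_, h3⟩
      rcases Int.units_eq_one_or (sgn σ i) with h4 | h4
      · exact h4
      · simp [invWeight, h3, h3.not_gt, h4] at h2
    · simp [invWeight, h3, h3.not_gt, ha, h1] at h2
  have hs : ∀ m (hm : m < n), sgn σ ⟨m, hm⟩ = 1 := by
    intro m
    induction m with
    | zero => exact fun hm => h0 _ rfl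
    | succ m ih => exact fun hm => (step ⟨m, by omega⟩ ⟨m + 1, hm⟩ rfl (ih _)).1
  apply sigmaB_ext
  · cases n with
    | zero => exact fun k => k.elim0
    | succ n =>
      have hmono : StrictMono (absPerm σ) := Fin.strictMono_iff_lt_succ.2 fun i =>
        (step i.castSucc i.succ (by simp) (hs _ _)).2
      have : absPerm σ = Equiv.refl _ := by
        have := Subsingleton.elim (hmono.orderIsoOfSurjective _ (absPerm σ).surjective)
          (OrderIso.refl _)
        ext k
        exact congrArg Fin.val (DFunLike.congr_fun this k)
      intro k
      rw [this]; rfl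
  · exact fun k => hs k.1 k.2

/-- Induction on `negCount + invCount`: a nontrivial σ has a descent, and multiplying by that
generator lowers the corresponding statistic by one and fixes the other. The generator is then
appended to the word of the product. -/
theorem exists_word_count (σ : SigmaB n) : ∃ w : List (Fin n), (w.map gen).prod = σ ∧
    w.countP (fun i : Fin n => decide ((i : ℕ) = 0)) = negCount σ ∧
      w.countP (fun i : Fin n => decide ((i : ℕ) ≠ 0)) = invCount σ := by
  induction hN : negCount σ + invCount σ using Nat.strong_induction_on generalizing σ with
  | _ N ih =>
  by_cases h0 : ∀ i : Fin n, (i : ℕ) = 0 → sgn σ i = 1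
  · by_cases h : ∀ a i : Fin n, (a : ℕ) + 1 = i → invWeight σ a i ≤ invWeight σ i a
    · refine ⟨[], ?_⟩
      rw [eq_one_of_no_descent σ h0 h]
      simp
    · push Not at h
      obtain ⟨a, i, hai, hlt⟩ := h
      have hi : (i : ℕ) ≠ 0 := by omega
      have h1 := invCount_mul_gen_pos σ i a hai
      -- Applied to the product, the bound says that the statistic drops by at most one; with the
      -- strict descent in `h1` it drops by exactly one.
      have h2 := invCount_mul_gen_pos_le (σ * gen i) i hi
      rw [mul_assoc, gen_mul_self, mul_one] at h2
      have h3 := negCount_mul_gen_pos σ i hi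
      obtain ⟨w, hw, hw1, hw2⟩ := ih _ (by omega) (σ * gen i) rfl
      refine ⟨w ++ [i], by simp [hw, mul_assoc, gen_mul_self], ?_, ?_⟩
      · rw [List.countP_append, hw1, h3]; simp [hi]
      · rw [List.countP_append, hw2]; simp [hi]; omega
  · push Not at h0
    obtain ⟨i, hi, hs⟩ := h0
    have h1 := negCount_mul_gen_zero_of_neg σ i hi ((Int.units_eq_one_or _).resolve_left hs)
    have h2 := invCount_mul_gen_zero σ i hi
    obtain ⟨w, hw, hw1, hw2⟩ := ih _ (by omega) (σ * gen i) rfl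
    refine ⟨w ++ [i], by simp [hw, mul_assoc, gen_mul_self], ?_, ?_⟩
    · rw [List.countP_append, hw1]; simp [hi]; omega
    · rw [List.countP_append, hw2, h2]; simp [hi]

/-- A reduced word is no longer than the word of `exists_word_count`, whose length is the sum of the
two lower bounds of `negCount_prod_le`; both bounds must then be equalities. This makes the sets in
`l₁` and `l₂` singletons. -/
theorem IsReducedWord.count_eq {σ : SigmaB n} {w : List (Fin n)} (h : IsReducedWord σ w) :
    w.countP (fun i : Fin n => decide ((i : ℕ) = 0)) = negCount σ ∧
      w.countP (fun i : Fin n => decide ((i : ℕ) ≠ 0)) = invCount σ := by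
  obtain ⟨v, hv, hv1, hv2⟩ := exists_word_count σ
  have h1 := h.2 v hv
  have h2 := negCount_prod_le w
  rw [h.1] at h2
  have hlen : ∀ u : List (Fin n), u.length = u.countP (fun i : Fin n => decide ((i : ℕ) = 0)) +
      u.countP (fun i : Fin n => decide ((i : ℕ) ≠ 0)) := fun u => by
    rw [List.length_eq_countP_add_countP (fun i : Fin n => decide ((i : ℕ) = 0)) (l := u)]
    simp
  rw [hlen v, hlen w] at h1
  omega

theorem exists_isReducedWord (σ : SigmaB n) : ∃ w, IsReducedWord σ w := by
  obtain ⟨v, hv, -⟩ := exists_word_count σ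
  have hex : ∃ k, ∃ w : List (Fin n), (w.map gen).prod = σ ∧ w.length = k := ⟨_, v, hv, rfl⟩
  classical
  obtain ⟨w, hw, hk⟩ := Nat.find_spec hex
  exact ⟨w, hw, fun u hu => hk ▸ Nat.find_min' hex ⟨u, hu, rfl⟩⟩

/-- In `l₁` and `l₂` the word is coerced to a list of naturals through the list monad before
counting; this translates back to `List (Fin n)`. -/
theorem countP_coe (w : List (Fin n)) (p : ℕ → Bool) :
    (do let a ← w; pure (a : ℕ) : List ℕ).countP p = w.countP (fun i : Fin n => p i) := by
  induction w with
  | nil => rfl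
  | cons a w ih => simpa [List.countP_cons, add_comm] using ih

theorem l₁_eq_negCount (σ : SigmaB n) : l₁ σ = negCount σ := by
  obtain ⟨w, hw⟩ := exists_isReducedWord σ
  have : {k | ∃ w, IsReducedWord σ w ∧ k = w.countP (fun i => decide ((i : ℕ) = 0))} =
      {negCount σ} := by
    ext k
    constructor
    · rintro ⟨u, hu, rfl⟩
      exact (countP_coe u _).trans hu.count_eq.1
    · rintro rfl
      exact ⟨w, hw, ((countP_coe w _).trans hw.count_eq.1).symm⟩
  rw [l₁, this, csInf_singleton]

theorem l₂_eq_invCount (σ : SigmaB n) : l₂ σ = invCount σ := by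
  obtain ⟨w, hw⟩ := exists_isReducedWord σ
  have : {k | ∃ w, IsReducedWord σ w ∧ k = w.countP (fun i => decide ((i : ℕ) ≠ 0))} =
      {invCount σ} := by
    ext k
    constructor
    · rintro ⟨u, hu, rfl⟩
      exact (countP_coe u _).trans hu.count_eq.2
    · rintro rfl
      exact ⟨w, hw, ((countP_coe w _).trans hw.count_eq.2).symm⟩
  rw [l₂, this, csInf_singleton]

/-- The generators are involutions, so reversing a word inverts its product. Both statistics are
therefore invariant under inversion, which is not visible from the definition of `invCount` and is
what makes the form Hermitian. -/
theorem IsReducedWord.reverse {σ : SigmaB n} {w : List (Fin n)} (h : IsReducedWord σ w) :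
    IsReducedWord σ⁻¹ w.reverse := by
  have key : ∀ u : List (Fin n), (u.reverse.map gen).prod = ((u.map gen).prod)⁻¹ := by
    intro u
    rw [List.prod_inv_reverse, List.map_map, List.map_reverse]
    congr 3
    ext1 i
    exact (gen_inv i).symm
  refine ⟨by rw [key, h.1], fun v hv => ?_⟩
  rw [List.length_reverse, ← List.length_reverse (as := v)]
  exact h.2 _ (by rw [key, hv, inv_inv])

theorem negCount_inv (σ : SigmaB n) : negCount σ⁻¹ = negCount σ := by
  obtain ⟨w, hw⟩ := exists_isReducedWord σ
  rw [← hw.count_eq.1, ← hw.reverse.count_eq.1, List.countP_reverse]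

theorem invCount_inv (σ : SigmaB n) : invCount σ⁻¹ = invCount σ := by
  obtain ⟨w, hw⟩ := exists_isReducedWord σ
  rw [← hw.count_eq.2, ← hw.reverse.count_eq.2, List.countP_reverse]

/-! ### Cosets of `Σ(n)` in `Σ(n + 1)` -/

/-- The permutation of `Fin (n + 1)` which maps `k` to the last point and is `p` elsewhere. -/
def extendPerm (k : Fin (n + 1)) (p : Equiv.Perm (Fin n)) : Equiv.Perm (Fin (n + 1)) :=
  (finSuccEquiv' k).trans ((Equiv.optionCongr p).trans (finSuccEquiv' (Fin.last n)).symm)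

@[simp] theorem extendPerm_self (k : Fin (n + 1)) (p : Equiv.Perm (Fin n)) :
    extendPerm k p k = Fin.last n := by
  simp [extendPerm]

@[simp] theorem extendPerm_succAbove (k : Fin (n + 1)) (p : Equiv.Perm (Fin n)) (j : Fin n) :
    extendPerm k p (k.succAbove j) = (p j).castSucc := by
  simp [extendPerm]

/-- The signed permutation which maps `k` to `s` times the last point and is `τ` elsewhere. -/
def extend (k : Fin (n + 1)) (s : ℤˣ) (τ : SigmaB n) : SigmaB (n + 1) :=
  ofPermSign (extendPerm k (absPerm τ)) (k.insertNth (α := fun _ => ℤˣ) s (sgn τ))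

@[simp] theorem absPerm_extend_self (k : Fin (n + 1)) (s : ℤˣ) (τ : SigmaB n) :
    absPerm (extend k s τ) k = Fin.last n := by
  simp [extend]

@[simp] theorem absPerm_extend_succAbove (k : Fin (n + 1)) (s : ℤˣ) (τ : SigmaB n) (j : Fin n) :
    absPerm (extend k s τ) (k.succAbove j) = (absPerm τ j).castSucc := by
  simp [extend]

@[simp] theorem sgn_extend_self (k : Fin (n + 1)) (s : ℤˣ) (τ : SigmaB n) :
    sgn (extend k s τ) k = s := by
  simp [extend]

@[simp] theorem sgn_extend_succAbove (k : Fin (n + 1)) (s : ℤˣ) (τ : SigmaB n) (j : Fin n) :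
    sgn (extend k s τ) (k.succAbove j) = sgn τ j := by
  simp [extend]

theorem extend_bijective (n : ℕ) :
    Function.Bijective (fun a : Fin (n + 1) × ℤˣ × SigmaB n => extend a.1 a.2.1 a.2.2) := by
  rw [Fintype.bijective_iff_injective_and_card]
  constructor
  · rintro ⟨k, s, τ⟩ ⟨k', s', τ'⟩ h
    dsimp only at h
    have hk : k = k' := by
      -- The position k is recovered as the preimage of the last point.
      apply (absPerm (extend k s τ)).injective
      conv_rhs => rw [h]
      simp
    subst hk
    have hs : s = s' := by
      have := congrArg (fun ρ => sgn ρ k) h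
      simpa using this
    have hτ : τ = τ' := by
      apply sigmaB_ext <;> intro j
      · have := congrArg (fun ρ => absPerm ρ (k.succAbove j)) h
        simpa using this
      · have := congrArg (fun ρ => sgn ρ (k.succAbove j)) h
        simpa using this
    rw [hs, hτ]
  · rw [Fintype.card_prod, Fintype.card_prod, card_sigmaB, card_sigmaB, Fintype.card_fin,
      Fintype.card_units_int, Nat.factorial_succ, pow_succ]
    ring

theorem sum_sigmaB_succ {M : Type*} [AddCommMonoid M] (F : SigmaB (n + 1) → M) :
    ∑ σ, F σ = ∑ k, ∑ s, ∑ τ, F (extend k s τ) := by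
  rw [← (extend_bijective n).sum_comp F, Fintype.sum_prod_type]
  exact Finset.sum_congr rfl fun k _ => Fintype.sum_prod_type _

theorem negCount_extend (k : Fin (n + 1)) (s : ℤˣ) (τ : SigmaB n) :
    negCount (extend k s τ) = (if s = -1 then 1 else 0) + negCount τ := by
  rw [negCount, Fin.sum_univ_succAbove _ k]
  simp [negCount]

theorem sum_lt_succAbove (k : Fin (n + 1)) :
    ∑ j, (if k < k.succAbove j then 1 else 0) = n - (k : ℕ) := by
  have h := Fin.sum_univ_succAbove (fun j => if k < j then 1 else 0) k
  rw [Finset.sum_boole] at h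
  simp at h
  rw [Finset.sum_boole]
  rw [Nat.cast_id, ← h, Finset.filter_lt_eq_Ioi, Fin.card_Ioi]
  omega

theorem sum_succAbove_lt (k : Fin (n + 1)) :
    ∑ j, (if k.succAbove j < k then 1 else 0) = (k : ℕ) := by
  have h := Fin.sum_univ_succAbove (fun j => if j < k then 1 else 0) k
  rw [Finset.sum_boole] at h
  simp at h
  rw [Finset.sum_boole]
  rw [Nat.cast_id, ← h, Finset.filter_gt_eq_Iio, Fin.card_Iio]

/-- Position k carries the largest absolute value. Each of the n-k later positions contributes 1,
each of the k earlier ones contributes 2 or 0 according to s, and all other pairs are those of τ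
because `succAbove` is increasing. -/
theorem invCount_extend (k : Fin (n + 1)) (s : ℤˣ) (τ : SigmaB n) :
    invCount (extend k s τ) = (n - (k : ℕ)) + (if s = -1 then 2 * (k : ℕ) else 0) +
      invCount τ := by
  have h1 : ∑ j, (if k < k.succAbove j then invWeight (extend k s τ) k (k.succAbove j) else 0) =
      n - (k : ℕ) := by
    rw [← sum_lt_succAbove k]
    refine Finset.sum_congr rfl fun j _ => ?_
    simp [invWeight, Fin.castSucc_lt_last]
  have h2 : ∑ i, (if k.succAbove i < k then invWeight (extend k s τ) (k.succAbove i) k else 0) =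
      if s = -1 then 2 * (k : ℕ) else 0 := by
    have h3 : ∀ i, (if k.succAbove i < k then invWeight (extend k s τ) (k.succAbove i) k else 0) =
        (if s = -1 then 2 else 0) * (if k.succAbove i < k then 1 else 0) := by
      intro i
      have : ¬ (Fin.last n < (absPerm τ i).castSucc) := not_lt.2 (Fin.le_last _)
      simp [invWeight, this]
    rw [Finset.sum_congr rfl fun i _ => h3 i, ← Finset.mul_sum, sum_succAbove_lt]
    split_ifs <;> simp
  have h4 : ∀ i j, (if k.succAbove i < k.succAbove j then
      invWeight (extend k s τ) (k.succAbove i) (k.succAbove j) else 0) =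
      if i < j then invWeight τ i j else 0 := by
    intro i j
    simp [invWeight, Fin.succAbove_lt_succAbove_iff]
  rw [invCount, Fin.sum_univ_succAbove _ k, Fin.sum_univ_succAbove _ k, h1]
  have h5 : ∀ i, ∑ j, (if k.succAbove i < j then
      invWeight (extend k s τ) (k.succAbove i) j else 0) =
      (if k.succAbove i < k then invWeight (extend k s τ) (k.succAbove i) k else 0) +
        ∑ j, if i < j then invWeight τ i j else 0 := by
    intro i
    rw [Fin.sum_univ_succAbove _ k, Finset.sum_congr rfl fun j _ => h4 i j]
  rw [Finset.sum_congr rfl fun i _ => h5 i, Finset.sum_add_distrib, h2]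
  simp [invCount]
  ring

end Group

/-! ## The annihilation operator -/

section FockSpace

variable {H : Type*} [NormedAddCommGroup H] [InnerProductSpace ℂ H]

/-- The element `y_1 ⊗ ⋯ ⊗ y_m` of the Fock space. -/
noncomputable def pureTensor {m : ℕ} (y : Fin m → H) : Fock H :=
  DirectSum.lof ℂ ℕ (fun n => ⨂[ℂ]^n H) m (PiTensorProduct.tprod ℂ y)

theorem vacuum_eq_pureTensor (y : Fin 0 → H) : vacuum H = pureTensor y := by
  rw [Subsingleton.elim y Fin.elim0]; rfl

theorem fock_induction {P : Fock H → Prop} (pure : ∀ (m : ℕ) (y : Fin m → H), P (pureTensor y))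
    (add : ∀ f g, P f → P g → P (f + g)) (smul : ∀ (c : ℂ) f, P f → P (c • f)) (f : Fock H) :
    P f := by
  induction f using DirectSum.induction_on with
  | zero => simpa using smul 0 _ (pure 0 Fin.elim0)
  | of m t =>
    change P (DirectSum.lof ℂ ℕ (fun n => ⨂[ℂ]^n H) m t)
    induction t using PiTensorProduct.induction_on with
    | smul_tprod r y => rw [map_smul]; exact smul _ _ (pure m y)
    | add s t hs ht => rw [map_add]; exact add _ _ hs ht
  | add f g hf hg => exact add _ _ hf hg

/-- `z` or `z̄`, according to a sign. -/
def signBar (J : H →ₗ[ℂ] H) (s : ℤˣ) (z : H) : H := if s = 1 then z else J z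

@[simp] theorem signBar_one (J : H →ₗ[ℂ] H) (z : H) : signBar J 1 z = z := by simp [signBar]

@[simp] theorem signBar_neg_one (J : H →ₗ[ℂ] H) (z : H) : signBar J (-1) z = J z := by
  have : (-1 : ℤˣ) ≠ 1 := by decide
  simp [signBar, this]

theorem inner_signBar (J : H →ₗ[ℂ] H) (hJ : J.IsSymmetric) (s : ℤˣ) (y z : H) :
    inner ℂ (signBar J s y) z = inner ℂ y (signBar J s z) := by
  rcases Int.units_eq_one_or s with rfl | rfl
  · simp
  · simpa using hJ y z

/-- The values of `⟨·,·⟩_{α,q}` on the elementary tensors of degree `n`. -/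
noncomputable def symForm (α q : ℝ) (J : H →ₗ[ℂ] H) {n : ℕ} (y z : Fin n → H) : ℂ :=
  ∑ σ : SigmaB n, (α : ℂ) ^ negCount σ * (q : ℂ) ^ invCount σ *
    ∏ k, inner ℂ (y (absPerm σ k)) (signBar J (sgn σ k) (z k))

theorem tensorForm_symmetrization (α q : ℝ) (J : H →ₗ[ℂ] H) {n : ℕ} (y z : Fin n → H) :
    tensorForm n (symmetrization α q J n (PiTensorProduct.tprod ℂ z))
      (PiTensorProduct.tprod ℂ y) = symForm α q J y z := by
  simp only [symmetrization, LinearMap.sum_apply, LinearMap.smul_apply, map_sum, map_smul,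
    act_tprod, tensorForm_tprod, symForm, l₁_eq_negCount, l₂_eq_invCount, smul_eq_mul]
  refine Finset.sum_congr rfl fun σ _ => ?_
  congr 1
  rw [← Equiv.prod_comp (absPerm σ)]
  simp [signBar]

theorem fockInner_pureTensor (α q : ℝ) (J : H →ₗ[ℂ] H) {n : ℕ} (y z : Fin n → H) :
    fockInner α q J (pureTensor y) (pureTensor z) = symForm α q J y z := by
  rw [pureTensor, pureTensor, fockInner_lof, DirectSum.lof_apply, tensorForm_symmetrization]

theorem fockInner_pureTensor_of_ne (α q : ℝ) (J : H →ₗ[ℂ] H) {m n : ℕ} (h : m ≠ n)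
    (y : Fin m → H) (z : Fin n → H) :
    fockInner α q J (pureTensor y) (pureTensor z) = 0 := by
  rw [pureTensor, pureTensor, fockInner_lof, DirectSum.lof_eq_of, DirectSum.of_eq_of_ne _ _ _ h.symm,
    map_zero]

/-- Substitute σ⁻¹ for σ: the statistics are invariant, the coefficients are real, and symmetry of J
moves each bar to the other argument. -/
theorem symForm_conj (α q : ℝ) (J : H →ₗ[ℂ] H) (hJ : J.IsSymmetric) {n : ℕ} (y z : Fin n → H) :
    (starRingEnd ℂ) (symForm α q J y z) = symForm α q J z y := by
  simp only [symForm, map_sum, map_mul, map_pow, Complex.conj_ofReal, map_prod, inner_conj_symm]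
  rw [← Equiv.sum_comp (Equiv.inv (SigmaB n))]
  refine Finset.sum_congr rfl fun σ _ => ?_
  rw [Equiv.inv_apply, negCount_inv, invCount_inv]
  congr 1
  rw [← Equiv.prod_comp (absPerm σ)]
  refine Finset.prod_congr rfl fun k _ => ?_
  rw [absPerm_inv_apply, sgn_inv_apply, inner_signBar J hJ]

theorem symForm_zero (α q : ℝ) (J : H →ₗ[ℂ] H) (y z : Fin 0 → H) : symForm α q J y z = 1 := by
  have : Fintype.card (SigmaB 0) = 1 := by simp [card_sigmaB]
  simp [symForm, negCount, invCount, this]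

variable (α q : ℝ) (J : H →ₗ[ℂ] H)

theorem fockInner_add_left (f g h : Fock H) :
    fockInner α q J (f + g) h = fockInner α q J f h + fockInner α q J g h := by
  simp [fockInner]

theorem fockInner_add_right (f g h : Fock H) :
    fockInner α q J f (g + h) = fockInner α q J f g + fockInner α q J f h := by
  simp [fockInner]

theorem fockInner_sub_right (f g h : Fock H) :
    fockInner α q J f (g - h) = fockInner α q J f g - fockInner α q J f h := by
  simp [fockInner]

theorem fockInner_smul_left (c : ℂ) (f g : Fock H) :
    fockInner α q J (c • f) g = (starRingEnd ℂ) c * fockInner α q J f g := by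
  simp [fockInner]

theorem fockInner_smul_right (c : ℂ) (f g : Fock H) :
    fockInner α q J f (c • g) = c * fockInner α q J f g := by
  simp [fockInner]

theorem fockInner_sum_right {ι : Type*} (s : Finset ι) (f : Fock H) (g : ι → Fock H) :
    fockInner α q J f (∑ i ∈ s, g i) = ∑ i ∈ s, fockInner α q J f (g i) := by
  simp [fockInner]

theorem fockInner_zero_right (f : Fock H) : fockInner α q J f 0 = 0 := by
  simp [fockInner]

theorem fockInner_conj (hJ : J.IsSymmetric) (f g : Fock H) :
    (starRingEnd ℂ) (fockInner α q J f g) = fockInner α q J g f := by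
  induction f using fock_induction with
  | add f f' hf hf' => rw [fockInner_add_left, fockInner_add_right, map_add, hf, hf']
  | smul c f hf => rw [fockInner_smul_left, fockInner_smul_right, map_mul, hf, Complex.conj_conj]
  | pure m y =>
    induction g using fock_induction with
    | add f f' hf hf' => rw [fockInner_add_left, fockInner_add_right, map_add, hf, hf']
    | smul c f hf => rw [fockInner_smul_left, fockInner_smul_right, map_mul, hf]
    | pure n z =>
      rcases eq_or_ne m n with rfl | h
      · rw [fockInner_pureTensor, fockInner_pureTensor, symForm_conj _ _ _ hJ]
      · rw [fockInner_pureTensor_of_ne _ _ _ h, fockInner_pureTensor_of_ne _ _ _ h.symm, map_zero]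

/-- The functional by which `b(x)` annihilates the `k`-th of `m + 1` factors. -/
noncomputable def contraction {m : ℕ} (x : H) (k : Fin (m + 1)) : H →ₗ[ℂ] ℂ :=
  (q : ℂ) ^ (m - (k : ℕ)) • innerₛₗ ℂ x +
    ((α : ℂ) * (q : ℂ) ^ (m + (k : ℕ))) • (innerₛₗ ℂ x ∘ₗ J)

theorem contraction_apply {m : ℕ} (x : H) (k : Fin (m + 1)) (z : H) :
    contraction α q J x k z = (q : ℂ) ^ (m - (k : ℕ)) * inner ℂ x z +
      (α : ℂ) * (q : ℂ) ^ (m + (k : ℕ)) * inner ℂ x (J z) := by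
  simp [contraction]

/-- Splitting m + k as (m - k) + 2k separates the future crossings from the future coverings. -/
theorem contraction_eq {m : ℕ} (x : H) (k : Fin (m + 1)) (z : H) :
    contraction α q J x k z = (q : ℂ) ^ (m - (k : ℕ)) *
      (inner ℂ x z + (α : ℂ) * (q : ℂ) ^ (2 * (k : ℕ)) * inner ℂ x (J z)) := by
  have : m + (k : ℕ) = (m - k) + 2 * k := by omega
  rw [contraction_apply, this, pow_add]
  ring

/-- The sum over Σ(m+1) is sorted by the factor z_k that meets the appended x, and by its sign. The
two signs give the two terms of `contraction`, with exponents m - k and (m - k) + 2k from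
`invCount_extend`. -/
theorem symForm_snoc {m : ℕ} (y : Fin m → H) (x : H) (z : Fin (m + 1) → H) :
    symForm α q J (Fin.snoc y x : Fin (m + 1) → H) z =
      ∑ k, contraction α q J x k (z k) * symForm α q J y (z ∘ k.succAbove) := by
  rw [symForm, sum_sigmaB_succ]
  refine Finset.sum_congr rfl fun k _ => ?_
  have h : ∀ s : ℤˣ, ∀ τ : SigmaB m,
      ∏ j, inner ℂ ((Fin.snoc y x : Fin (m + 1) → H) (absPerm (extend k s τ) j))
        (signBar J (sgn (extend k s τ) j) (z j)) =
      inner ℂ x (signBar J s (z k)) *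
        ∏ j, inner ℂ (y (absPerm τ j)) (signBar J (sgn τ j) (z (k.succAbove j))) := by
    intro s τ
    rw [Fin.prod_univ_succAbove _ k]
    simp
  have hk : (k : ℕ) ≤ m := by omega
  have huniv : (Finset.univ : Finset ℤˣ) = {1, -1} := rfl
  have hne : (1 : ℤˣ) ≠ -1 := by decide
  have hexp : m - (k : ℕ) + 2 * k = m + k := by omega
  rw [huniv, Finset.sum_pair hne, contraction_apply, add_mul, symForm, Finset.mul_sum,
    Finset.mul_sum]
  congr 1 <;> refine Finset.sum_congr rfl fun τ _ => ?_
  · rw [h, negCount_extend, invCount_extend, if_neg hne, if_neg hne, zero_add, add_zero, pow_add,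
      signBar_one]
    simp only [Function.comp]
    ring
  · rw [h, negCount_extend, invCount_extend, if_pos rfl, if_pos rfl, hexp, pow_add, pow_add,
      signBar_neg_one]
    simp only [Function.comp]
    ring

/-- The operator `y_0 ⊗ ⋯ ⊗ y_m ↦ ∑_k q^{m-k} (⟨x, y_k⟩ + α q^{2k} ⟨x, ȳ_k⟩)
y_0 ⊗ ⋯ ŷ_k ⋯ ⊗ y_m`. -/
noncomputable def contractOp (x : H) : Module.End ℂ (Fock H) :=
  DirectSum.toModule ℂ ℕ (Fock H) fun n =>
    match n with
    | 0 => 0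
    | m + 1 => DirectSum.lof ℂ ℕ (fun n => ⨂[ℂ]^n H) m ∘ₗ
        PiTensorProduct.lift (∑ k : Fin (m + 1),
          LinearMap.uncurryMid (M := fun _ : Fin (m + 1) => H) k
            ((contraction α q J x k).smulRight
              (PiTensorProduct.tprod ℂ (s := fun _ : Fin m => H))))

theorem contractOp_pureTensor_zero (x : H) (y : Fin 0 → H) :
    contractOp α q J x (pureTensor y) = 0 := by
  rw [contractOp, pureTensor, DirectSum.toModule_lof]
  rfl

theorem contractOp_pureTensor_succ (x : H) {m : ℕ} (y : Fin (m + 1) → H) :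
    contractOp α q J x (pureTensor y) =
      ∑ k, contraction α q J x k (y k) • pureTensor (y ∘ k.succAbove) := by
  rw [contractOp, pureTensor, DirectSum.toModule_lof]
  change DirectSum.lof ℂ ℕ (fun n => ⨂[ℂ]^n H) m (PiTensorProduct.lift _ _) = _
  rw [PiTensorProduct.lift.tprod, sum_apply, map_sum]
  refine Finset.sum_congr rfl fun k _ => ?_
  rw [LinearMap.uncurryMid_apply, LinearMap.smulRight_apply, smul_apply, map_smul]
  rfl

theorem creation_pureTensor (x : H) {m : ℕ} (y : Fin m → H) :
    creation x (pureTensor y) = pureTensor (Fin.snoc y x : Fin (m + 1) → H) :=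
  creation_tprod x y

theorem isCreationAdjoint_contractOp (x : H) :
    IsCreationAdjoint α q J x (contractOp α q J x) := by
  intro f g
  induction f using fock_induction with
  | add f f' hf hf' => rw [map_add, fockInner_add_left, fockInner_add_left, hf, hf']
  | smul c f hf => rw [map_smul, fockInner_smul_left, fockInner_smul_left, hf]
  | pure m y =>
    induction g using fock_induction with
    | add f f' hf hf' => rw [map_add, fockInner_add_right, fockInner_add_right, hf, hf']
    | smul c f hf => rw [map_smul, fockInner_smul_right, fockInner_smul_right, hf]
    | pure n z =>
      rw [creation_pureTensor]
      cases n with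
      | zero =>
        rw [contractOp_pureTensor_zero, fockInner_zero_right,
          fockInner_pureTensor_of_ne _ _ _ (by omega)]
      | succ n =>
        rw [contractOp_pureTensor_succ, fockInner_sum_right]
        simp only [fockInner_smul_right]
        rcases eq_or_ne m n with rfl | h
        · simp only [fockInner_pureTensor]
          rw [symForm_snoc]
        · rw [fockInner_pureTensor_of_ne _ _ _ (by omega)]
          simp [fockInner_pureTensor_of_ne _ _ _ h]

theorem isCreationAdjoint_annihilation (x : H) :
    IsCreationAdjoint α q J x (annihilation α q J x) := by
  have h : ∃ T, IsCreationAdjoint α q J x T := ⟨_, isCreationAdjoint_contractOp α q J x⟩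
  rw [annihilation, dif_pos h]
  exact h.choose_spec

/-! ## Operator words modulo the radical of the form -/

/-- `g` is in the radical of `⟨·,·⟩_{α,q}`. -/
def InRadical (g : Fock H) : Prop := ∀ f, fockInner α q J f g = 0

variable {α q J}

theorem InRadical.add {g h : Fock H} (hg : InRadical α q J g) (hh : InRadical α q J h) :
    InRadical α q J (g + h) := fun f => by
  rw [fockInner_add_right, hg f, hh f, add_zero]

theorem inRadical_zero : InRadical α q J 0 := fun f => fockInner_zero_right α q J f

theorem IsCreationAdjoint.inRadical {x : H} {T : Module.End ℂ (Fock H)}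
    (hT : IsCreationAdjoint α q J x T) {g : Fock H} (hg : InRadical α q J g) :
    InRadical α q J (T g) := fun f => by rw [← hT f g, hg]

/-- This replaces uniqueness of the adjoint: the arbitrary choice in `annihilation` is invisible to
the form. -/
theorem IsCreationAdjoint.inRadical_sub {x : H} {T T' : Module.End ℂ (Fock H)}
    (hT : IsCreationAdjoint α q J x T) (hT' : IsCreationAdjoint α q J x T') (g : Fock H) :
    InRadical α q J (T g - T' g) := fun f => by
  rw [fockInner_sub_right, ← hT, ← hT', sub_self]

theorem fockInner_creation_right (hJ : J.IsSymmetric) {x : H} {T : Module.End ℂ (Fock H)}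
    (hT : IsCreationAdjoint α q J x T) (f g : Fock H) :
    fockInner α q J f (creation x g) = fockInner α q J (T f) g := by
  rw [← fockInner_conj α q J hJ, hT, fockInner_conj α q J hJ]

theorem InRadical.creation (hJ : J.IsSymmetric) (x : H) {g : Fock H} (hg : InRadical α q J g) :
    InRadical α q J (creation x g) := fun f => by
  rw [fockInner_creation_right hJ (isCreationAdjoint_contractOp α q J x), hg]

/-- Letters may be changed one at a time modulo the radical, provided one of the two families
preserves it. -/
theorem inRadical_word_sub {ι : Type*} (A A' : ι → Module.End ℂ (Fock H))
    (hA : ∀ i g, InRadical α q J g → InRadical α q J (A i g))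
    (hAA' : ∀ i g, InRadical α q J (A' i g - A i g)) (l : List ι) (g : Fock H) :
    InRadical α q J ((l.map A').prod g - (l.map A).prod g) := by
  induction l with
  | nil => simpa using inRadical_zero
  | cons a l ih =>
    simp only [List.map_cons, List.prod_cons, Module.End.mul_apply]
    -- Telescoping, with W and W' the two shorter words: A'W'g - AWg = (A' - A)W'g + A(W'g - Wg).
    have := (hAA' a ((l.map A').prod g)).add (hA a _ ih)
    rwa [map_sub, sub_add_sub_cancel] at this

theorem fockInner_word_reverse {ι : Type*} (A : ι → Module.End ℂ (Fock H))
    (hA : ∀ i f g, fockInner α q J f (A i g) = fockInner α q J (A i f) g) (l : List ι)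
    (f g : Fock H) :
    fockInner α q J f ((l.map A).prod g) = fockInner α q J ((l.reverse.map A).prod f) g := by
  induction l generalizing f with
  | nil => simp
  | cons a l ih =>
    simp only [List.map_cons, List.prod_cons, Module.End.mul_apply, List.reverse_cons,
      List.map_append, List.prod_append, List.map_nil, List.prod_nil, mul_one]
    rw [hA, ih]

theorem fockInner_gaussian (hJ : J.IsSymmetric) (x : H) (f g : Fock H) :
    fockInner α q J f (gaussian α q J x g) = fockInner α q J (gaussian α q J x f) g := by
  have h := isCreationAdjoint_annihilation α q J x
  rw [gaussian, LinearMap.add_apply, LinearMap.add_apply, fockInner_add_right, fockInner_add_left,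
    fockInner_creation_right hJ h, ← h, add_comm]

variable (α q J) in
/-- The operator `b^*(z) + b(w)`, with the explicit formula for `b(w)`. -/
noncomputable def wickOp (z w : H) : Module.End ℂ (Fock H) := creation z + contractOp α q J w

theorem InRadical.wickOp (hJ : J.IsSymmetric) (z w : H) {g : Fock H} (hg : InRadical α q J g) :
    InRadical α q J (wickOp α q J z w g) :=
  (hg.creation hJ z).add ((isCreationAdjoint_contractOp α q J w).inRadical hg)

theorem inRadical_gaussian_sub (x : H) (g : Fock H) :
    InRadical α q J (gaussian α q J x g - wickOp α q J x x g) := by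
  have h := (isCreationAdjoint_annihilation α q J x).inRadical_sub
    (isCreationAdjoint_contractOp α q J x) g
  rw [gaussian, wickOp, LinearMap.add_apply, LinearMap.add_apply, add_comm (creation x g),
    add_sub_add_right_eq_sub]
  exact h

/-- With `creation_zero`, this presents b^* and b as `wickOp` with one argument 0, so that a single
Wick formula serves both the ε-words and the Gaussian words. -/
theorem contractOp_zero : contractOp α q J (0 : H) = 0 := by
  have h : ∀ m (k : Fin (m + 1)), contraction α q J 0 k = 0 := fun m k => by
    simp [contraction]
  refine LinearMap.ext fun f => ?_
  induction f using fock_induction with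
  | add f g hf hg => rw [map_add, map_add, hf, hg]
  | smul c f hf => rw [map_smul, map_smul, hf]
  | pure m y =>
    cases m with
    | zero => rw [contractOp_pureTensor_zero]; rfl
    | succ m => rw [contractOp_pureTensor_succ]; simp [h]

theorem creation_zero : creation (0 : H) = 0 := by
  refine LinearMap.ext fun f => ?_
  induction f using fock_induction with
  | add f g hf hg => rw [map_add, map_add, hf, hg]
  | smul c f hf => rw [map_smul, map_smul, hf]
  | pure m y =>
    rw [creation_pureTensor, pureTensor,
      MultilinearMap.map_coord_zero _ (Fin.last m) (Fin.snoc_last _ _), map_zero]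
    rfl

theorem inRadical_bOp_star_sub (x : H) (g : Fock H) :
    InRadical α q J (bOp α q J Exponent.star x g - wickOp α q J x 0 g) := by
  have : bOp α q J Exponent.star x g - wickOp α q J x 0 g = 0 := by
    simp [bOp, wickOp, contractOp_zero]
  rw [this]
  exact inRadical_zero

theorem inRadical_bOp_one_sub (x : H) (g : Fock H) :
    InRadical α q J (bOp α q J Exponent.one x g - wickOp α q J 0 x g) := by
  have h := (isCreationAdjoint_annihilation α q J x).inRadical_sub
    (isCreationAdjoint_contractOp α q J x) g
  rw [wickOp, creation_zero, zero_add]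
  exact h

end FockSpace

/-! ## Pairings of finite sets of points -/

section Pairings

variable {n : ℕ}

/-- `P` is a partition of `S` into pairs. -/
def IsPairing (S : Finset (Fin n)) (P : Finset (Finset (Fin n))) : Prop :=
  (∀ V ∈ P, V.card = 2 ∧ V ⊆ S) ∧ (∀ s ∈ S, ∃ V ∈ P, s ∈ V) ∧
    ∀ V ∈ P, ∀ W ∈ P, ∀ s, s ∈ V → s ∈ W → V = W

open Classical in
/-- The number of crossings of a set of blocks. -/
noncomputable def crossingCount (P : Finset (Finset (Fin n))) : ℕ :=
  ((P.powersetCard 2).filter (fun S => ∃ V ∈ S, ∃ W ∈ S, V ≠ W ∧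
    ∃ i ∈ V, ∃ j ∈ V, ∃ k ∈ W, ∃ l ∈ W, i < k ∧ k < j ∧ j < l)).card

open Classical in
/-- The number of blocks in `P` which cover `V`. -/
noncomputable def coverCount (P : Finset (Finset (Fin n))) (V : Finset (Fin n)) : ℕ :=
  (P.filter (fun W => Covers W V)).card

open Classical in
/-- The pairings of `L ∪ {t, …, n - 1}` in which every pair has an element in `{t, …, n - 1}`. -/
noncomputable def openPairings (L : Finset (Fin n)) (t : ℕ) : Finset (Finset (Finset (Fin n))) :=
  Finset.univ.filter (fun P => IsPairing (L ∪ Finset.univ.filter (fun s : Fin n => t ≤ s)) P ∧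
    ∀ V ∈ P, ∃ b ∈ V, t ≤ (b : ℕ))

theorem mem_openPairings {L : Finset (Fin n)} {t : ℕ} {P : Finset (Finset (Fin n))} :
    P ∈ openPairings L t ↔ (∀ V ∈ P, V.card = 2) ∧ (∀ V ∈ P, ∀ s ∈ V, s ∈ L ∨ t ≤ (s : ℕ)) ∧
      (∀ s, s ∈ L ∨ t ≤ (s : ℕ) → ∃ V ∈ P, s ∈ V) ∧
      (∀ V ∈ P, ∀ W ∈ P, ∀ s, s ∈ V → s ∈ W → V = W) ∧ ∀ V ∈ P, ∃ b ∈ V, t ≤ (b : ℕ) := by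
  simp only [openPairings, Finset.mem_filter, Finset.mem_univ, true_and]
  simp only [IsPairing, Finset.mem_filter, Finset.mem_univ, true_and, Finset.mem_union,
    Finset.subset_iff]
  constructor
  · rintro ⟨⟨h1, h2, h3⟩, h4⟩
    exact ⟨fun V hV => (h1 V hV).1, fun V hV => (h1 V hV).2, h2, h3, h4⟩
  · rintro ⟨h1, h1', h2, h3, h4⟩
    exact ⟨⟨fun V hV => ⟨h1 V hV, h1' V hV⟩, h2, h3⟩, h4⟩

theorem eq_of_mem_card_two {V : Finset (Fin n)} (hV : V.card = 2) {a b c : Fin n} (ha : a ∈ V)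
    (hb : b ∈ V) (hc : c ∈ V) (hac : a ≠ c) (hbc : b ≠ c) : a = b := by
  obtain ⟨u, v, huv, rfl⟩ := Finset.card_eq_two.1 hV
  simp only [Finset.mem_insert, Finset.mem_singleton] at ha hb hc
  rcases ha with rfl | rfl <;> rcases hb with rfl | rfl <;> rcases hc with rfl | rfl <;>
    simp_all

/-- No point is left to close a pair, so there are no pairs and nothing may be open. -/
theorem openPairings_end (L : Finset (Fin n)) :
    openPairings L n = if L = ∅ then {∅} else ∅ := by
  ext P
  rw [mem_openPairings]
  constructor
  · rintro ⟨-, -, h3, -, h5⟩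
    have hP : P = ∅ := Finset.eq_empty_of_forall_notMem fun V hV => by
      obtain ⟨b, -, hb⟩ := h5 V hV
      omega
    subst hP
    have hL : L = ∅ := Finset.eq_empty_of_forall_notMem fun s hs => by
      obtain ⟨V, hV, -⟩ := h3 s (Or.inl hs)
      simp at hV
    simp [hL]
  · intro h
    split_ifs at h with hL
    · rw [Finset.mem_singleton] at h
      subst h hL
      simp
    · simp at h

theorem insert_pair_mem_openPairings {L : Finset (Fin n)} {T a : Fin n}
    (hL : ∀ l ∈ L, l < T) (ha : a ∈ L) {P : Finset (Finset (Fin n))}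
    (hP : P ∈ openPairings (L.erase a) (T + 1)) : insert {a, T} P ∈ openPairings L T := by
  rw [mem_openPairings] at hP ⊢
  obtain ⟨h1, h2, h3, h4, h5⟩ := hP
  have haT := hL a ha
  have hnot : ∀ V ∈ P, a ∉ V ∧ T ∉ V := by
    refine fun V hV => ⟨fun h => ?_, fun h => ?_⟩
    · rcases h2 V hV a h with h' | h'
      · simp at h'
      · rw [Fin.lt_def] at haT; omega
    · rcases h2 V hV T h with h' | h'
      · exact absurd (hL T (Finset.mem_of_mem_erase h')) (lt_irrefl _)
      · omega
  simp only [Finset.mem_insert, Finset.mem_singleton, forall_eq_or_imp, exists_eq_or_imp]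
  refine ⟨⟨Finset.card_pair haT.ne, h1⟩, ⟨⟨Or.inl ha, ?_⟩, ?_⟩, ?_, ⟨⟨by simp, ?_⟩, ?_⟩, ?_, ?_⟩
  · rintro _ rfl; right; rfl
  · intro V hV s hs
    rcases h2 V hV s hs with h | h
    · exact Or.inl (Finset.mem_of_mem_erase h)
    · right; omega
  · intro s hs
    by_cases hsa : s = a
    · exact Or.inl (Or.inl hsa)
    by_cases hsT : s = T
    · exact Or.inl (Or.inr hsT)
    right
    refine h3 s (hs.imp (fun h => Finset.mem_erase.2 ⟨hsa, h⟩) fun h => ?_)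
    have := Fin.val_ne_of_ne hsT
    omega
  · refine fun W hW => ⟨fun hs => absurd hs (hnot W hW).1, ?_⟩
    rintro _ rfl hs
    exact absurd hs (hnot W hW).2
  · intro V hV
    refine ⟨?_, h4 V hV⟩
    rintro s hs (rfl | rfl)
    · exact absurd hs (hnot V hV).1
    · exact absurd hs (hnot V hV).2
  · right; simp
  · intro V hV
    obtain ⟨b, hb, hb'⟩ := h5 V hV
    exact ⟨b, hb, by omega⟩

theorem erase_pair_mem_openPairings {L : Finset (Fin n)} {T a : Fin n}
    (hL : ∀ l ∈ L, l < T) (haT : a < T) {P : Finset (Finset (Fin n))}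
    (hP : P ∈ openPairings L T) (hB : {a, T} ∈ P) :
    P.erase {a, T} ∈ openPairings (L.erase a) (T + 1) := by
  rw [mem_openPairings] at hP ⊢
  obtain ⟨h1, h2, h3, h4, h5⟩ := hP
  have hnot : ∀ V ∈ P.erase {a, T}, a ∉ V ∧ T ∉ V := by
    intro V hV
    rw [Finset.mem_erase] at hV
    exact ⟨fun h => hV.1 (h4 V hV.2 _ hB a h (by simp)),
      fun h => hV.1 (h4 V hV.2 _ hB T h (by simp))⟩
  refine ⟨fun V hV => h1 V (Finset.mem_of_mem_erase hV), fun V hV s hs => ?_, fun s hs => ?_,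
    fun V hV W hW => h4 V (Finset.mem_of_mem_erase hV) W (Finset.mem_of_mem_erase hW),
    fun V hV => ?_⟩
  · rcases h2 V (Finset.mem_of_mem_erase hV) s hs with h | h
    · refine Or.inl (Finset.mem_erase.2 ⟨?_, h⟩)
      rintro rfl
      exact (hnot V hV).1 hs
    · right
      have : s ≠ T := by
        rintro rfl
        exact (hnot V hV).2 hs
      have := Fin.val_ne_of_ne this
      omega
  · obtain ⟨V, hV, hsV⟩ := h3 s (hs.imp Finset.mem_of_mem_erase fun h => by omega)
    refine ⟨V, Finset.mem_erase.2 ⟨?_, hV⟩, hsV⟩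
    rintro rfl
    simp only [Finset.mem_insert, Finset.mem_singleton] at hsV
    rw [Fin.lt_def] at haT
    rcases hsV with rfl | rfl
    · rcases hs with h | h
      · simp at h
      · omega
    · rcases hs with h | h
      · exact absurd (hL s (Finset.mem_of_mem_erase h)) (lt_irrefl _)
      · omega
  · obtain ⟨b, hb, hb'⟩ := h5 V (Finset.mem_of_mem_erase hV)
    refine ⟨b, hb, ?_⟩
    have : b ≠ T := by
      rintro rfl
      exact (hnot V hV).2 hb
    have := Fin.val_ne_of_ne this
    omega

/-- The ground set is unchanged when T joins the open points; the only new demand is that the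
partner of T comes later. -/
theorem mem_openPairings_insert_iff {L : Finset (Fin n)} {T : Fin n}
    {P : Finset (Finset (Fin n))} : P ∈ openPairings (insert T L) (T + 1) ↔
      P ∈ openPairings L T ∧ ¬ ∃ V ∈ P, T ∈ V ∧ ∀ b ∈ V, b ≤ T := by
  rw [mem_openPairings, mem_openPairings]
  have hS : ∀ s : Fin n, (s ∈ insert T L ∨ (T : ℕ) + 1 ≤ s) ↔ (s ∈ L ∨ (T : ℕ) ≤ s) := by
    intro s
    rw [Finset.mem_insert, Fin.ext_iff]
    constructor
    · rintro ((h | h) | h)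
      · right; omega
      · exact Or.inl h
      · right; omega
    · rintro (h | h)
      · exact Or.inl (Or.inr h)
      · rcases h.eq_or_lt with h | h
        · exact Or.inl (Or.inl h.symm)
        · exact Or.inr h
  simp only [hS]
  constructor
  · rintro ⟨h1, h2, h3, h4, h5⟩
    refine ⟨⟨h1, h2, h3, h4, fun V hV => ?_⟩, ?_⟩
    · obtain ⟨b, hb, hb'⟩ := h5 V hV
      exact ⟨b, hb, by omega⟩
    · rintro ⟨V, hV, -, hle⟩
      obtain ⟨b, hb, hb'⟩ := h5 V hV
      have := hle b hb
      rw [Fin.le_def] at this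
      omega
  · rintro ⟨⟨h1, h2, h3, h4, h5⟩, h6⟩
    refine ⟨h1, h2, h3, h4, fun V hV => ?_⟩
    obtain ⟨b, hb, hb'⟩ := h5 V hV
    rcases hb'.eq_or_lt with h | h
    · have hbT : b = T := Fin.ext h.symm
      subst hbT
      by_contra hcon
      push Not at hcon
      exact h6 ⟨V, hV, hb, fun c hc => Fin.le_def.2 (by have := hcon c hc; omega)⟩
    · exact ⟨b, hb, h⟩

theorem notMem_of_mem_openPairings {L : Finset (Fin n)} {T a : Fin n} (hL : ∀ l ∈ L, l < T)
    {P : Finset (Finset (Fin n))} (hP : P ∈ openPairings (L.erase a) (T + 1)) :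
    ∀ V ∈ P, T ∉ V := by
  intro V hV h
  rcases (mem_openPairings.1 hP).2.1 V hV T h with h' | h'
  · exact absurd (hL T (Finset.mem_of_mem_erase h')) (lt_irrefl _)
  · omega

/-- Pairings according to the role of the point `T`, which opens or closes a pair. -/
theorem sum_openPairings {M : Type*} [AddCommMonoid M] {L : Finset (Fin n)} {T : Fin n}
    (hL : ∀ l ∈ L, l < T) (F : Finset (Finset (Fin n)) → M) :
    ∑ P ∈ openPairings L T, F P = ∑ P ∈ openPairings (insert T L) (T + 1), F P +
      ∑ a ∈ L, ∑ P ∈ openPairings (L.erase a) (T + 1), F (insert {a, T} P) := by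
  classical
  -- The criterion is whether T is the larger point of its pair. If not, T is opened; if so, its
  -- partner a is one of the open points, and removing the pair leaves a pairing with a and T gone.
  rw [← Finset.sum_filter_not_add_sum_filter (openPairings L T)
    (fun P => ∃ V ∈ P, T ∈ V ∧ ∀ b ∈ V, b ≤ T)]
  congr 1
  · refine Finset.sum_congr ?_ fun _ _ => rfl
    ext P
    rw [Finset.mem_filter, mem_openPairings_insert_iff]
  · rw [Finset.sum_sigma']
    symm
    refine Finset.sum_bij (fun x _ => insert {x.1, T} x.2) ?_ ?_ ?_ fun _ _ => rfl
    · rintro ⟨a, P⟩ h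
      rw [Finset.mem_sigma] at h
      refine Finset.mem_filter.2 ⟨insert_pair_mem_openPairings hL h.1 h.2, {a, T},
        Finset.mem_insert_self _ _, by simp, ?_⟩
      simp [(hL a h.1).le]
    · rintro ⟨a, P⟩ h ⟨a', P'⟩ h' heq
      rw [Finset.mem_sigma] at h h'
      have hP := notMem_of_mem_openPairings hL h.2
      have hP' := notMem_of_mem_openPairings hL h'.2
      dsimp only at heq h h' hP hP'
      have hB : ({a, T} : Finset (Fin n)) ∉ P := fun hB => hP _ hB (by simp)
      have hB' : ({a', T} : Finset (Fin n)) ∉ P' := fun hB => hP' _ hB (by simp)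
      have hmem : ({a, T} : Finset (Fin n)) ∈ insert {a', T} P' :=
        heq ▸ Finset.mem_insert_self _ _
      have hpair : ({a, T} : Finset (Fin n)) = {a', T} :=
        (Finset.mem_insert.1 hmem).resolve_right fun hB => hP' _ hB (by simp)
      have haa : a = a' := by
        have : a ∈ ({a', T} : Finset (Fin n)) := hpair ▸ Finset.mem_insert_self _ _
        simp only [Finset.mem_insert, Finset.mem_singleton] at this
        exact this.resolve_right (hL a h.1).ne
      subst haa
      rw [← Finset.erase_insert hB, heq, Finset.erase_insert hB']
    · intro P hP
      rw [Finset.mem_filter] at hP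
      obtain ⟨hP, V, hV, hTV, hle⟩ := hP
      have hP' := mem_openPairings.1 hP
      obtain ⟨a, ha, haT⟩ : ∃ a ∈ V, a ≠ T :=
        Finset.exists_mem_ne (by rw [hP'.1 V hV]; norm_num) T
      have hVeq : V = {a, T} := by
        symm
        apply Finset.eq_of_subset_of_card_le
        · simp [Finset.insert_subset_iff, ha, hTV]
        · rw [hP'.1 V hV, Finset.card_pair haT]
      subst hVeq
      have hlt : a < T := lt_of_le_of_ne (hle a ha) haT
      refine ⟨⟨a, P.erase {a, T}⟩, Finset.mem_sigma.2 ⟨?_, erase_pair_mem_openPairings hL hlt hP hV⟩,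
        Finset.insert_erase hV⟩
      refine (hP'.2.1 _ hV a ha).resolve_right ?_
      rw [Fin.lt_def] at hlt
      omega

/-! ### Statistics after adding a pair -/

/-- Every open point lies in exactly one block, and no block holds two of them, because each block
also needs a point at least t. Counting blocks thus becomes counting open points. -/
theorem card_blocks_filter {L : Finset (Fin n)} {t : ℕ} (hL : ∀ l ∈ L, (l : ℕ) < t)
    {P : Finset (Finset (Fin n))} (hP : P ∈ openPairings L t) (p : Fin n → Prop)
    [DecidablePred p] [DecidablePred fun V : Finset (Fin n) => ∃ l ∈ V, l ∈ L ∧ p l] :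
    (P.filter (fun V => ∃ l ∈ V, l ∈ L ∧ p l)).card = (L.filter p).card := by
  obtain ⟨h1, -, h3, h4, h5⟩ := mem_openPairings.1 hP
  have : ∀ l ∈ L, ∃ V ∈ P, l ∈ V := fun l hl => h3 l (Or.inl hl)
  choose! f hf hf' using this
  symm
  refine Finset.card_bij (fun l _ => f l) ?_ ?_ ?_
  · intro l hl
    rw [Finset.mem_filter] at hl
    exact Finset.mem_filter.2 ⟨hf l hl.1, l, hf' l hl.1, hl⟩
  · intro l hl l' hl' h
    rw [Finset.mem_filter] at hl hl'
    obtain ⟨b, hb, hbt⟩ := h5 _ (hf l hl.1)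
    have hne : ∀ l ∈ L, l ≠ b := by
      rintro l hl rfl
      have := hL l hl
      omega
    exact eq_of_mem_card_two (h1 _ (hf l hl.1)) (hf' l hl.1) (h ▸ hf' l' hl'.1) hb
      (hne l hl.1) (hne l' hl'.1)
  · intro V hV
    obtain ⟨hV, l, hlV, hlL, hp⟩ := Finset.mem_filter.1 hV
    exact ⟨l, Finset.mem_filter.2 ⟨hlL, hp⟩, h4 _ (hf l hlL) _ hV l (hf' l hlL) hlV⟩

/-- The new unordered pairs of blocks are the {B, V} with V in P. The predicate p is left free so
that crossing with B can be replaced by a more convenient condition. -/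
theorem crossingCount_insert {B : Finset (Fin n)} {P : Finset (Finset (Fin n))} (hB : B ∉ P)
    {p : Finset (Fin n) → Prop} [DecidablePred p] (hp : ∀ V ∈ P, p V ↔
      (∃ i ∈ B, ∃ j ∈ B, ∃ k ∈ V, ∃ l ∈ V, i < k ∧ k < j ∧ j < l) ∨
      (∃ i ∈ V, ∃ j ∈ V, ∃ k ∈ B, ∃ l ∈ B, i < k ∧ k < j ∧ j < l)) :
    crossingCount (insert B P) = crossingCount P + (P.filter p).card := by
  classical
  unfold crossingCount
  rw [Finset.powersetCard_succ_insert hB, Finset.filter_union, Finset.card_union_of_disjoint]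
  · congr 1
    symm
    refine Finset.card_bij (fun V _ => {B, V}) ?_ ?_ ?_
    · intro V hV
      rw [Finset.mem_filter] at hV
      have hne : B ≠ V := by rintro rfl; exact hB hV.1
      refine Finset.mem_filter.2 ⟨Finset.mem_image.2 ⟨{V}, ?_, rfl⟩, ?_⟩
      · simp [Finset.mem_powersetCard, hV.1]
      · rcases (hp V hV.1).1 hV.2 with h | h
        · exact ⟨B, by simp, V, by simp, hne, h⟩
        · exact ⟨V, by simp, B, by simp, hne.symm, h⟩
    · intro V hV W hW h
      rw [Finset.mem_filter] at hV hW
      have : V ∈ ({B, W} : Finset (Finset (Fin n))) := by rw [← h]; simp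
      simp only [Finset.mem_insert, Finset.mem_singleton] at this
      exact this.resolve_left (by rintro rfl; exact hB hV.1)
    · intro S hS
      obtain ⟨hS, V₁, hV₁, V₂, hV₂, hne, hcr⟩ := Finset.mem_filter.1 hS
      obtain ⟨S', hS', rfl⟩ := Finset.mem_image.1 hS
      rw [Finset.mem_powersetCard] at hS'
      obtain ⟨V, rfl⟩ := Finset.card_eq_one.1 hS'.2
      have hV : V ∈ P := hS'.1 (by simp)
      refine ⟨V, Finset.mem_filter.2 ⟨hV, (hp V hV).2 ?_⟩, rfl⟩
      simp only [Finset.mem_insert, Finset.mem_singleton] at hV₁ hV₂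
      rcases hV₁ with rfl | rfl <;> rcases hV₂ with rfl | rfl
      · exact absurd rfl hne
      · exact Or.inl hcr
      · exact Or.inr hcr
      · exact absurd rfl hne
  · refine Finset.disjoint_filter_filter (Finset.disjoint_left.2 fun S hS hS' => ?_)
    obtain ⟨S', -, rfl⟩ := Finset.mem_image.1 hS'
    exact hB ((Finset.mem_powersetCard.1 hS).1 (Finset.mem_insert_self _ _))

variable {L : Finset (Fin n)} {T a : Fin n} {P : Finset (Finset (Fin n))}

/-- Every other block ends after T, so it crosses {a, T} exactly when it starts at an open point
between a and T. -/
theorem crossingCount_insert_pair (hL : ∀ l ∈ L, l < T) (ha : a ∈ L)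
    (hP : P ∈ openPairings (L.erase a) (T + 1)) :
    crossingCount (insert {a, T} P) = crossingCount P + (L.filter (fun l => a < l)).card := by
  classical
  have hT := notMem_of_mem_openPairings hL hP
  have haT := hL a ha
  obtain ⟨h1, h2, h3, h4, h5⟩ := mem_openPairings.1 hP
  have hlt : ∀ l ∈ L.erase a, (l : ℕ) < (T : ℕ) + 1 := fun l hl => by
    have := Fin.lt_def.1 (hL l (Finset.mem_of_mem_erase hl)); omega
  have hmem : ∀ V ∈ P, ∀ s ∈ V, s < T → s ∈ L.erase a := fun V hV s hs hsT =>
    (h2 V hV s hs).resolve_right (by rw [Fin.lt_def] at hsT; omega)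
  rw [crossingCount_insert (fun hB => hT _ hB (by simp))
    (p := fun V => ∃ l ∈ V, l ∈ L.erase a ∧ a < l), card_blocks_filter hlt hP]
  · congr 2
    ext l
    simp only [Finset.mem_filter, Finset.mem_erase]
    exact ⟨fun h => ⟨h.1.2, h.2⟩, fun h => ⟨⟨h.2.ne', h.1⟩, h.2⟩⟩
  · intro V hV
    obtain ⟨b, hb, hbT⟩ := h5 V hV
    have hTb : T < b := Fin.lt_def.2 (by omega)
    constructor
    · rintro ⟨l, hl, hlL, hal⟩
      exact Or.inl ⟨a, by simp, T, by simp, l, hl, b, hb, hal,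
        hL l (Finset.mem_of_mem_erase hlL), hTb⟩
    · rintro (⟨i, hi, j, hj, k, hk, l, hl, hik, hkj, hjl⟩ | ⟨i, hi, j, hj, k, hk, l, hl, hik, hkj, hjl⟩)
      · have hij := hik.trans hkj
        simp only [Finset.mem_insert, Finset.mem_singleton] at hi hj
        rcases hi with rfl | rfl <;> rcases hj with rfl | rfl
        · exact absurd hij (lt_irrefl _)
        · exact ⟨k, hk, hmem V hV k hk hkj, hik⟩
        · exact absurd hij haT.not_gt
        · exact absurd hij (lt_irrefl _)
      · have hlT : l ≤ T := by
          simp only [Finset.mem_insert, Finset.mem_singleton] at hl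
          rcases hl with rfl | rfl
          · exact haT.le
          · exact le_rfl
        have hjb : j < b := (hjl.trans_le hlT).trans hTb
        exact absurd (eq_of_mem_card_two (h1 V hV) hi hj hb ((hik.trans hkj).trans hjb).ne hjb.ne)
          (hik.trans hkj).ne

/-- Every other block ends after T, so it covers {a, T} exactly when it starts at an open point
before a. -/
theorem coverCount_insert_pair_self (hL : ∀ l ∈ L, l < T) (ha : a ∈ L)
    (hP : P ∈ openPairings (L.erase a) (T + 1)) :
    coverCount (insert {a, T} P) {a, T} = (L.filter (fun l => l < a)).card := by
  classical
  have haT := hL a ha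
  obtain ⟨h1, h2, h3, h4, h5⟩ := mem_openPairings.1 hP
  have hlt : ∀ l ∈ L.erase a, (l : ℕ) < (T : ℕ) + 1 := fun l hl => by
    have := Fin.lt_def.1 (hL l (Finset.mem_of_mem_erase hl)); omega
  have hself : ¬ Covers ({a, T} : Finset (Fin n)) {a, T} := by
    rintro ⟨i, hi, j, hj, h⟩
    exact lt_irrefl _ (h i hi).1
  unfold coverCount
  rw [Finset.filter_insert, if_neg hself]
  have : P.filter (fun W => Covers W {a, T}) =
      P.filter (fun V => ∃ l ∈ V, l ∈ L.erase a ∧ l < a) := by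
    refine Finset.filter_congr fun V hV => ?_
    obtain ⟨b, hb, hbT⟩ := h5 V hV
    have hTb : T < b := Fin.lt_def.2 (by omega)
    constructor
    · rintro ⟨i, hi, j, hj, h⟩
      have hia := (h a (by simp)).1
      refine ⟨i, hi, (h2 V hV i hi).resolve_right ?_, hia⟩
      have := Fin.lt_def.1 (hia.trans haT)
      omega
    · rintro ⟨l, hl, hlL, hla⟩
      refine ⟨l, hl, b, hb, ?_⟩
      simp [hla, hla.trans haT, hTb, haT.trans hTb]
  rw [this, card_blocks_filter hlt hP]
  congr 1
  ext l
  simp only [Finset.mem_filter, Finset.mem_erase]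
  exact ⟨fun h => ⟨h.1.2, h.2⟩, fun h => ⟨⟨h.2.ne, h.1⟩, h.2⟩⟩

/-- Every block of P has a point beyond T, so the new pair covers none of them. -/
theorem coverCount_insert_pair_of_mem (hL : ∀ l ∈ L, l < T) (ha : a ∈ L)
    (hP : P ∈ openPairings (L.erase a) (T + 1)) {V : Finset (Fin n)} (hV : V ∈ P) :
    coverCount (insert {a, T} P) V = coverCount P V := by
  classical
  obtain ⟨b, hb, hbT⟩ := (mem_openPairings.1 hP).2.2.2.2 V hV
  have hnot : ¬ Covers ({a, T} : Finset (Fin n)) V := by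
    rintro ⟨i, hi, j, hj, h⟩
    have hjb := Fin.lt_def.1 (h b hb).2
    have haT := Fin.lt_def.1 (hL a ha)
    simp only [Finset.mem_insert, Finset.mem_singleton] at hj
    rcases hj with rfl | rfl <;> omega
  unfold coverCount
  rw [Finset.filter_insert, if_neg hnot]

theorem card_image_filter_gt {m : ℕ} {y : Fin (m + 1) → Fin n} (hy : StrictMono y)
    (k : Fin (m + 1)) :
    ((Finset.univ.image y).filter (fun l => y k < l)).card = m - (k : ℕ) := by
  have : (Finset.univ.image y).filter (fun l => y k < l) = (Finset.Ioi k).image y := by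
    ext l
    simp only [Finset.mem_filter, Finset.mem_image, Finset.mem_univ, true_and, Finset.mem_Ioi]
    constructor
    · rintro ⟨⟨j, rfl⟩, h⟩
      exact ⟨j, hy.lt_iff_lt.1 h, rfl⟩
    · rintro ⟨j, h, rfl⟩
      exact ⟨⟨j, rfl⟩, hy h⟩
  rw [this, Finset.card_image_of_injective _ hy.injective, Fin.card_Ioi]
  omega

theorem card_image_filter_lt {m : ℕ} {y : Fin (m + 1) → Fin n} (hy : StrictMono y)
    (k : Fin (m + 1)) :
    ((Finset.univ.image y).filter (fun l => l < y k)).card = (k : ℕ) := by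
  have : (Finset.univ.image y).filter (fun l => l < y k) = (Finset.Iio k).image y := by
    ext l
    simp only [Finset.mem_filter, Finset.mem_image, Finset.mem_univ, true_and, Finset.mem_Iio]
    constructor
    · rintro ⟨⟨j, rfl⟩, h⟩
      exact ⟨j, hy.lt_iff_lt.1 h, rfl⟩
    · rintro ⟨j, h, rfl⟩
      exact ⟨⟨j, rfl⟩, hy h⟩
  rw [this, Finset.card_image_of_injective _ hy.injective, Fin.card_Iio]

/-- The weight of a set of pairs, for a function `c` of pairs and of numbers of covering pairs. -/
noncomputable def pairingWeight (q : ℝ) (c : ℕ → Fin n → Fin n → ℂ)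
    (P : Finset (Finset (Fin n))) : ℂ :=
  (q : ℂ) ^ crossingCount P * ∏ V ∈ P, onPair (c (coverCount P V)) V

/-- As y lists the open points in increasing order, m-k of them follow y_k and k precede it; the
resulting factor is that of `contraction_eq`. -/
theorem pairingWeight_insert_pair (q : ℝ) (c : ℕ → Fin n → Fin n → ℂ) {m : ℕ}
    {y : Fin (m + 1) → Fin n} (hy : StrictMono y) (hT : ∀ i, y i < T) (k : Fin (m + 1))
    (hP : P ∈ openPairings ((Finset.univ.image y).erase (y k)) (T + 1)) :
    pairingWeight q c (insert {y k, T} P) =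
      (q : ℂ) ^ (m - (k : ℕ)) * c k (y k) T * pairingWeight q c P := by
  have hL : ∀ l ∈ Finset.univ.image y, l < T := by simpa using hT
  have ha : y k ∈ Finset.univ.image y := by simp
  have hB : ({y k, T} : Finset (Fin n)) ∉ P := fun hB =>
    notMem_of_mem_openPairings hL hP _ hB (by simp)
  unfold pairingWeight
  rw [crossingCount_insert_pair hL ha hP, Finset.prod_insert hB,
    coverCount_insert_pair_self hL ha hP, card_image_filter_gt hy, card_image_filter_lt hy,
    onPair_pair _ (hT k), Finset.prod_congr rfl fun V hV => by
      rw [coverCount_insert_pair_of_mem hL ha hP hV], pow_add]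
  ring

end Pairings

/-! ## The Wick formula -/

section Wick

variable {H : Type*} [NormedAddCommGroup H] [InnerProductSpace ℂ H]
variable (α q : ℝ) (J : H →ₗ[ℂ] H)

theorem fockInner_vacuum_pureTensor {m : ℕ} (y : Fin m → H) :
    fockInner α q J (vacuum H) (pureTensor y) = if m = 0 then 1 else 0 := by
  rw [vacuum_eq_pureTensor Fin.elim0]
  split_ifs with h
  · subst h
    rw [fockInner_pureTensor, symForm_zero]
  · exact fockInner_pureTensor_of_ne _ _ _ (Ne.symm h) _ _

/-- Induction on the number d of letters still to act, generalized over the state: t letters have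
acted, and y lists the open points in increasing order. -/
theorem fockInner_wick_from {n : ℕ} (z w : Fin n → H) (d : ℕ) :
    ∀ (t : ℕ), t + d = n → ∀ {m : ℕ} (y : Fin m → Fin n), StrictMono y → (∀ i, (y i : ℕ) < t) →
      fockInner α q J (vacuum H)
        (((((List.finRange n).drop t).reverse).map (fun i => wickOp α q J (z i) (w i))).prod
          (pureTensor (z ∘ y))) =
      ∑ P ∈ openPairings (Finset.univ.image y) t, pairingWeight q (fun c i j =>
        inner ℂ (w j) (z i) + (α : ℂ) * (q : ℂ) ^ (2 * c) * inner ℂ (w j) (J (z i))) P := by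
  induction d with
  | zero =>
    intro t ht m y _ _
    obtain rfl : t = n := by omega
    rw [List.drop_eq_nil_of_le (by simp), openPairings_end]
    simp only [List.reverse_nil, List.map_nil, List.prod_nil, Module.End.one_apply,
      fockInner_vacuum_pureTensor, Finset.image_eq_empty]
    cases m with
    | zero =>
      have : Finset.powersetCard 2 (∅ : Finset (Finset (Fin t))) = ∅ := rfl
      simp [pairingWeight, crossingCount, this]
    | succ m =>
      rw [if_neg (by simp), if_neg (Finset.univ_nonempty.ne_empty), Finset.sum_empty]
  | succ d ih =>
    intro t ht m y hy hyt
    have htn : t < n := by omega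
    set T : Fin n := ⟨t, htn⟩ with hTdef
    have hT : ∀ i, y i < T := fun i => Fin.lt_def.2 (hyt i)
    -- After the reversal, T is the rightmost letter of the remaining word, hence the next to act.
    have hdrop : (List.finRange n).drop t = T :: (List.finRange n).drop (t + 1) := by
      rw [List.drop_eq_getElem_cons (by simpa using htn)]
      simp [hTdef]
    have hL : ∀ l ∈ Finset.univ.image y, l < T := by simpa using hT
    have hsnoc : StrictMono (Fin.snoc y T : Fin (m + 1) → Fin n) := by
      intro i j hij
      induction j using Fin.lastCases with
      | last =>
        induction i using Fin.lastCases with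
        | last => exact absurd hij (lt_irrefl _)
        | cast i => simpa using hT i
      | cast j =>
        induction i using Fin.lastCases with
        | last => exact absurd hij (not_lt.2 (Fin.le_last _))
        | cast i => simpa using hy (by simpa using hij)
    have hsnoc_lt : ∀ i, ((Fin.snoc y T : Fin (m + 1) → Fin n) i : ℕ) < t + 1 := by
      intro i
      induction i using Fin.lastCases with
      | last => simp [hTdef]
      | cast i => have := hyt i; simp; omega
    have himage : Finset.univ.image (Fin.snoc y T : Fin (m + 1) → Fin n) =
        insert T (Finset.univ.image y) := by
      ext l
      simp [Fin.exists_fin_succ', eq_comm, or_comm]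
    have hsum := sum_openPairings hL (pairingWeight q (fun c i j =>
      inner ℂ (w j) (z i) + (α : ℂ) * (q : ℂ) ^ (2 * c) * inner ℂ (w j) (J (z i))))
    rw [show ((T : Fin n) : ℕ) = t from rfl] at hsum
    rw [hsum, hdrop]
    simp only [List.reverse_cons, List.map_append, List.prod_append, List.map_cons, List.map_nil,
      List.prod_cons, List.prod_nil, mul_one, Module.End.mul_apply]
    -- The creation term appends T to the open points and gives the first sum of `hsum`; the
    -- contraction term closes one of them and gives the second.
    rw [wickOp, LinearMap.add_apply, map_add, fockInner_add_right, creation_pureTensor,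
      ← Fin.comp_snoc, ih (t + 1) (by omega) _ hsnoc hsnoc_lt, himage]
    congr 1
    rw [Finset.sum_image hy.injective.injOn]
    cases m with
    | zero =>
      rw [contractOp_pureTensor_zero, map_zero, fockInner_zero_right]
      simp
    | succ m =>
      rw [contractOp_pureTensor_succ, map_sum, fockInner_sum_right]
      refine Finset.sum_congr rfl fun k _ => ?_
      have himage' : Finset.univ.image (y ∘ k.succAbove) = (Finset.univ.image y).erase (y k) := by
        ext l
        simp only [Finset.mem_image, Finset.mem_univ, true_and, Finset.mem_erase,
          Function.comp_apply]
        constructor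
        · rintro ⟨j, rfl⟩
          exact ⟨fun h => Fin.succAbove_ne k j (hy.injective h), _, rfl⟩
        · rintro ⟨hne, j, rfl⟩
          obtain ⟨i, rfl⟩ := Fin.exists_succAbove_eq (x := j) (y := k) (by rintro rfl; exact hne rfl)
          exact ⟨i, rfl⟩
      have h := ih (t + 1) (by omega) (y ∘ k.succAbove)
        (hy.comp (Fin.strictMono_succAbove k)) (fun i => by
          have := hyt (k.succAbove i); simp only [Function.comp_apply]; omega)
      rw [himage'] at h
      rw [map_smul, fockInner_smul_right, Function.comp_assoc, h, Finset.mul_sum]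
      refine Finset.sum_congr rfl fun P hP => ?_
      rw [pairingWeight_insert_pair q _ hy hT k hP, contraction_eq]
      rfl

open Classical in
-- At t = 0 nothing is open, and requiring a point at least 0 in every pair is no restriction.
theorem fockInner_wick {n : ℕ} (z w : Fin n → H) :
    fockInner α q J (vacuum H)
      (((List.finRange n).reverse.map (fun i => wickOp α q J (z i) (w i))).prod (vacuum H)) =
    ∑ P ∈ Finset.univ.filter (IsPairing (n := n) Finset.univ), pairingWeight q (fun c i j =>
      inner ℂ (w j) (z i) + (α : ℂ) * (q : ℂ) ^ (2 * c) * inner ℂ (w j) (J (z i))) P := by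
  have h := fockInner_wick_from α q J z w n 0 (by omega) (Fin.elim0 : Fin 0 → Fin n)
    (fun i => i.elim0) (fun i => i.elim0)
  rw [← vacuum_eq_pureTensor, List.drop_zero] at h
  rw [h]
  refine Finset.sum_congr ?_ fun _ _ => rfl
  ext P
  simp only [openPairings, Finset.mem_filter, Finset.mem_univ, true_and]
  have : Finset.univ.image (Fin.elim0 : Fin 0 → Fin n) ∪
      Finset.univ.filter (fun s : Fin n => 0 ≤ (s : ℕ)) = Finset.univ := by
    simp
  rw [this]
  refine ⟨fun h => h.1, fun h => ⟨h, fun V hV => ?_⟩⟩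
  obtain ⟨b, hb⟩ := Finset.card_pos.1 (by rw [(h.1 V hV).1]; norm_num : 0 < V.card)
  exact ⟨b, hb, Nat.zero_le _⟩

end Wick

/-! ## Pair partitions and pairings -/

section Partitions

variable {n : ℕ}

theorem mem_pairPartitions {π : SetPartition n} :
    π ∈ pairPartitions n ↔ IsPairPartition π := by
  simp [pairPartitions]

theorem mem_pairPartitionsComp {ε : Fin n → Exponent} {π : SetPartition n} :
    π ∈ pairPartitionsComp ε ↔ IsPairPartition π ∧ IsCompatible ε π := by
  simp [pairPartitionsComp]

theorem isPairing_parts {π : SetPartition n} (hπ : IsPairPartition π) :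
    IsPairing Finset.univ π.parts :=
  ⟨fun V hV => ⟨hπ V hV, Finset.subset_univ V⟩, fun _ hs => π.exists_mem hs,
    fun _ hV _ hW _ hsV hsW => π.eq_of_mem_parts hV hW hsV hsW⟩

open Classical in
-- Passes to bare sets of blocks, on which pairs can be inserted and erased without carrying
-- partition proofs.
theorem sum_pairPartitions {M : Type*} [AddCommMonoid M] (F : Finset (Finset (Fin n)) → M) :
    ∑ π ∈ pairPartitions n, F π.parts =
      ∑ P ∈ Finset.univ.filter (IsPairing (n := n) Finset.univ), F P := by
  refine Finset.sum_bij (fun π _ => π.parts) ?_ ?_ ?_ fun _ _ => rfl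
  · intro π hπ
    exact Finset.mem_filter.2 ⟨Finset.mem_univ _, isPairing_parts (mem_pairPartitions.1 hπ)⟩
  · exact fun π _ π' _ h => Finpartition.ext h
  · intro P hP
    obtain ⟨h1, h2, h3⟩ := (Finset.mem_filter.1 hP).2
    refine ⟨Finpartition.ofExistsUnique P (fun V hV => (h1 V hV).2) (fun s hs => ?_) fun h => ?_,
      mem_pairPartitions.2 fun V hV => (h1 V hV).1, rfl⟩
    · obtain ⟨V, hV, hsV⟩ := h2 s hs
      exact ⟨V, ⟨hV, hsV⟩, fun W hW => h3 W hW.1 V hV s hW.2 hsV⟩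
    · simpa using (h1 ∅ h).1

theorem sum_pairPartitionsB {M : Type*} [AddCommMonoid M] (F : SetPartitionB n → M) :
    ∑ p ∈ pairPartitionsB n, F p = ∑ π ∈ pairPartitions n, ∑ f : π.parts → ℤˣ, F ⟨π, f⟩ := by
  have : pairPartitionsB n = (pairPartitions n).sigma (fun _ => Finset.univ) := by
    ext p
    simp [pairPartitionsB, pairPartitions]
  rw [this, Finset.sum_sigma]

theorem sum_pairPartitionsBComp {M : Type*} [AddCommMonoid M] (ε : Fin n → Exponent)
    (F : SetPartitionB n → M) : ∑ p ∈ pairPartitionsBComp ε, F p =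
      ∑ π ∈ pairPartitionsComp ε, ∑ f : π.parts → ℤˣ, F ⟨π, f⟩ := by
  have : pairPartitionsBComp ε = (pairPartitionsComp ε).sigma (fun _ => Finset.univ) := by
    ext p
    simp [pairPartitionsBComp, pairPartitionsComp]
  rw [this, Finset.sum_sigma]

theorem onPair_congr {c c' : Fin n → Fin n → ℂ} {V : Finset (Fin n)}
    (h : ∀ i ∈ V, ∀ j ∈ V, i < j → c i j = c' i j) : onPair c V = onPair c' V := by
  refine Finset.prod_congr rfl fun ij hij => ?_
  rw [Finset.mem_filter, Finset.mem_product] at hij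
  exact h _ hij.1.1 _ hij.1.2 hij.2

theorem onPair_eq_zero {c : Fin n → Fin n → ℂ} {V : Finset (Fin n)} {i j : Fin n} (hi : i ∈ V)
    (hj : j ∈ V) (hij : i < j) (h : c i j = 0) : onPair c V = 0 :=
  Finset.prod_eq_zero (i := (i, j))
    (Finset.mem_filter.2 ⟨Finset.mem_product.2 ⟨hi, hj⟩, hij⟩) h

theorem onPair_add_mul (c c' : Fin n → Fin n → ℂ) (r : ℂ) {V : Finset (Fin n)}
    (hV : V.card = 2) :
    onPair (fun i j => c i j + r * c' i j) V = onPair c V + r * onPair c' V := by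
  obtain ⟨i, j, hij, rfl⟩ := Finset.card_eq_two.1 hV
  rcases lt_or_gt_of_ne hij with h | h
  · simp only [onPair_pair _ h]
  · rw [Finset.pair_comm]
    simp only [onPair_pair _ h]

theorem InNB_eq_sum (p : SetPartitionB n) (hp : IsPairPartition p.1) :
    InNB p = ∑ V : p.1.parts, if p.2 V = -1 then Cov p.1 V.1 else 0 := by
  classical
  rw [InNB, Finset.card_filter, Fintype.sum_prod_type]
  refine Finset.sum_congr rfl fun V _ => ?_
  split_ifs with h
  · rw [Cov, Finset.card_filter,
      ← Finset.sum_coe_sort p.1.parts (fun W => if Covers W V.1 then 1 else 0)]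
    refine Finset.sum_congr rfl fun W _ => ?_
    simp [h, hp V.1 V.2]
  · simp [h]

end Partitions

/-! ### Summation over colourings and comparison with operator words -/

section Weights

variable {H : Type*} [NormedAddCommGroup H] [InnerProductSpace ℂ H]
variable (α q : ℝ) (J : H →ₗ[ℂ] H) {n : ℕ} (x : Fin n → H)

theorem weight_eq_pairingWeight (π : SetPartition n) : weight α q J x π =
    pairingWeight q (fun c i j => inner ℂ (x i) (x j) +
      (α : ℂ) * (q : ℂ) ^ (2 * c) * inner ℂ (x i) (J (x j))) π.parts := rfl

/-- `InNB` is the sum of `Cov` over the negative blocks, so apart from the crossings the weight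
factors over the blocks, each factor depending only on the colour of its block. -/
theorem weightB_eq_prod (p : SetPartitionB n) (hp : IsPairPartition p.1) :
    weightB α q J x p = (q : ℂ) ^ Cr p.1 * ∏ V : p.1.parts,
      if p.2 V = 1 then onPair (fun i j => inner ℂ (x i) (x j)) V.1
      else (α : ℂ) * (q : ℂ) ^ (2 * Cov p.1 V.1) *
        onPair (fun i j => inner ℂ (x i) (J (x j))) V.1 := by
  classical
  have hfilter : Finset.univ.filter (fun V : p.1.parts => ¬ p.2 V = 1) =
      Finset.univ.filter (fun V : p.1.parts => p.2 V = -1) := by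
    refine Finset.filter_congr fun V _ => ?_
    rcases Int.units_eq_one_or (p.2 V) with h | h <;> rw [h] <;> decide
  have hNB : (α : ℂ) ^ NB p = ∏ V ∈ Finset.univ.filter (fun V : p.1.parts => p.2 V = -1),
      (α : ℂ) := by
    rw [Finset.prod_const]
    congr 1
  have hIn : (q : ℂ) ^ (2 * InNB p) =
      ∏ V ∈ Finset.univ.filter (fun V : p.1.parts => p.2 V = -1),
        (q : ℂ) ^ (2 * Cov p.1 V.1) := by
    rw [Finset.prod_pow_eq_pow_sum, ← Finset.mul_sum, InNB_eq_sum p hp, Finset.sum_filter]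
  rw [Finset.prod_ite, hfilter, Finset.prod_mul_distrib, Finset.prod_mul_distrib, ← hNB, ← hIn,
    weightB, pow_add]
  ring_nf

theorem sum_weightB (π : SetPartition n) (hπ : IsPairPartition π) :
    ∑ f : π.parts → ℤˣ, weightB α q J x ⟨π, f⟩ = weight α q J x π := by
  classical
  have huniv : (Finset.univ : Finset ℤˣ) = {1, -1} := rfl
  have hne : (1 : ℤˣ) ≠ -1 := by decide
  have hf : ∀ f : π.parts → ℤˣ, weightB α q J x ⟨π, f⟩ = (q : ℂ) ^ Cr π * ∏ V : π.parts,
      if f V = 1 then onPair (fun i j => inner ℂ (x i) (x j)) V.1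
      else (α : ℂ) * (q : ℂ) ^ (2 * Cov π V.1) *
        onPair (fun i j => inner ℂ (x i) (J (x j))) V.1 :=
    fun f => weightB_eq_prod α q J x ⟨π, f⟩ hπ
  rw [Finset.sum_congr rfl fun f _ => hf f, ← Finset.mul_sum, weight]
  congr 1
  -- Distributivity: a sum over colourings of a product of local factors is the product over the
  -- blocks of the two-term sums.
  have h := Finset.prod_univ_sum (fun _ : π.parts => (Finset.univ : Finset ℤˣ)) (fun V s =>
    if s = 1 then onPair (fun i j => inner ℂ (x i) (x j)) V.1
      else (α : ℂ) * (q : ℂ) ^ (2 * Cov π V.1) * onPair (fun i j => inner ℂ (x i) (J (x j))) V.1)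
  rw [Fintype.piFinset_univ] at h
  rw [← h, ← Finset.prod_coe_sort π.parts (fun V => onPair (fun i j => inner ℂ (x i) (x j) +
      (α : ℂ) * (q : ℂ) ^ (2 * Cov π V) * inner ℂ (x i) (J (x j))) V)]
  refine Finset.prod_congr rfl fun V _ => ?_
  rw [huniv, Finset.sum_pair hne, if_pos rfl, if_neg hne.symm, onPair_add_mul _ _ _ (hπ V.1 V.2)]

theorem sum_weightB_pairPartitionsB :
    ∑ p ∈ pairPartitionsB n, weightB α q J x p = ∑ π ∈ pairPartitions n, weight α q J x π := by
  rw [sum_pairPartitionsB]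
  exact Finset.sum_congr rfl fun π hπ => sum_weightB α q J x π (mem_pairPartitions.1 hπ)

theorem sum_weightB_pairPartitionsBComp (ε : Fin n → Exponent) :
    ∑ p ∈ pairPartitionsBComp ε, weightB α q J x p =
      ∑ π ∈ pairPartitionsComp ε, weight α q J x π := by
  rw [sum_pairPartitionsBComp]
  exact Finset.sum_congr rfl fun π hπ => sum_weightB α q J x π (mem_pairPartitionsComp.1 hπ).1

variable {α q J x}

/-- Symmetry of J together with `hbar` makes every ⟨x_i, x̄_j⟩ real, as `hre` does for ⟨x_i, x_j⟩.
-/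
theorem conj_weight (hre : ∀ i j, inner ℂ (x j) (x i) = inner ℂ (x i) (x j))
    (hJ : J.IsSymmetric) (hbar : ∀ i j, inner ℂ (x i) (J (x j)) = inner ℂ (x j) (J (x i)))
    (π : SetPartition n) : (starRingEnd ℂ) (weight α q J x π) = weight α q J x π := by
  have hbar' : ∀ i j, inner ℂ (J (x j)) (x i) = inner ℂ (x i) (J (x j)) := fun i j => by
    rw [hJ, hbar]
  simp only [weight, onPair, map_mul, map_pow, map_prod, map_add, Complex.conj_ofReal,
    inner_conj_symm, hre, hbar']

/-- The annihilating vector, which has the larger index, stands on the left in `fockInner_wick`,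
while `weight` has it on the right; `hre` and `hbar` exchange the two. -/
theorem wick_eq_sum_weight (hJ : J.IsSymmetric)
    (hre : ∀ i j, inner ℂ (x j) (x i) = inner ℂ (x i) (x j))
    (hbar : ∀ i j, inner ℂ (x i) (J (x j)) = inner ℂ (x j) (J (x i)))
    (A : Fin n → Module.End ℂ (Fock H))
    (hA : ∀ i g, InRadical α q J (A i g - wickOp α q J (x i) (x i) g)) :
    fockInner α q J (vacuum H) (((List.finRange n).reverse.map A).prod (vacuum H)) =
      ∑ π ∈ pairPartitions n, weight α q J x π := by
  have h := inRadical_word_sub (fun i => wickOp α q J (x i) (x i)) A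
    (fun i g hg => hg.wickOp hJ _ _) hA (List.finRange n).reverse (vacuum H) (vacuum H)
  rw [fockInner_sub_right, sub_eq_zero] at h
  rw [h, fockInner_wick, ← sum_pairPartitions]
  refine Finset.sum_congr rfl fun π _ => ?_
  rw [weight_eq_pairingWeight]
  simp only [hre, fun i j => hbar j i]

open Classical in
theorem wick_eq_sum_weight_comp (hJ : J.IsSymmetric)
    (hre : ∀ i j, inner ℂ (x j) (x i) = inner ℂ (x i) (x j))
    (hbar : ∀ i j, inner ℂ (x i) (J (x j)) = inner ℂ (x j) (J (x i))) (ε : Fin n → Exponent) :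
    fockInner α q J (vacuum H)
      (((List.finRange n).reverse.map (fun i => bOp α q J (ε i) (x i))).prod (vacuum H)) =
      ∑ π ∈ pairPartitionsComp ε, weight α q J x π := by
  -- A creation letter gets w = 0 and an annihilation letter gets z = 0, so a pair with incompatible
  -- exponents contributes a zero factor.
  set z : Fin n → H := fun i => if ε i = Exponent.star then x i else 0 with hz
  set w : Fin n → H := fun i => if ε i = Exponent.one then x i else 0 with hw
  have h := inRadical_word_sub (fun i => wickOp α q J (z i) (w i))
    (fun i => bOp α q J (ε i) (x i)) (fun i g hg => hg.wickOp hJ _ _) (fun i g => by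
      cases hε : ε i with
      | one => simpa [hz, hw, hε] using inRadical_bOp_one_sub (x i) g
      | star => simpa [hz, hw, hε] using inRadical_bOp_star_sub (x i) g)
    (List.finRange n).reverse (vacuum H) (vacuum H)
  rw [fockInner_sub_right, sub_eq_zero] at h
  rw [h, fockInner_wick, ← sum_pairPartitions]
  have hcomp : pairPartitionsComp ε = (pairPartitions n).filter (IsCompatible ε) := by
    ext π
    simp [pairPartitionsComp, pairPartitions]
  rw [hcomp, Finset.sum_filter]
  refine Finset.sum_congr rfl fun π _ => ?_
  split_ifs with hπ
  · rw [weight_eq_pairingWeight, pairingWeight, pairingWeight]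
    congr 1
    refine Finset.prod_congr rfl fun V hV => onPair_congr fun i hi j hj hij => ?_
    obtain ⟨h1, h2⟩ := hπ V hV i hi j hj hij
    simp only [hz, hw, h1, h2, if_true, hre i j, hbar j i]
  · simp only [IsCompatible, not_forall] at hπ
    obtain ⟨V, hV, a, ha, b, hb, hab, hε⟩ := hπ
    rw [pairingWeight, Finset.prod_eq_zero hV, mul_zero]
    refine onPair_eq_zero ha hb hab ?_
    rcases not_and_or.1 hε with h1 | h1 <;> simp [hz, hw, h1]

end Weights

end TypeBFock

theorem corollary3 {H : Type*} [NormedAddCommGroup H] [InnerProductSpace ℂ H] [CompleteSpace H]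
    [TopologicalSpace.SeparableSpace H]
    (HR : Submodule ℝ H) (hHR : TypeBFock.IsComplexificationOf HR)
    (J : H →ₗ[ℂ] H) (hJ_invol : ∀ x, J (J x) = x) (hJ_symm : J.IsSymmetric)
    (α q : ℝ) (hα : α ∈ Set.Ioo (-1 : ℝ) 1) (hq : q ∈ Set.Ioo (-1 : ℝ) 1)
    (n : ℕ) (x : Fin n → H) (hx : ∀ i, x i ∈ HR)
    (hx_bar : ∀ i j, inner ℂ (x i) (J (x j)) = inner ℂ (x j) (J (x i))) :
    (∀ ε : Fin n → TypeBFock.Exponent,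
      TypeBFock.fockInner α q J (TypeBFock.vacuum H)
          ((List.ofFn (fun i => TypeBFock.bOp α q J (ε i) (x i))).reverse.prod
            (TypeBFock.vacuum H)) =
        ∑ p ∈ TypeBFock.pairPartitionsBComp ε, TypeBFock.weightB α q J x p ∧
      ∑ p ∈ TypeBFock.pairPartitionsBComp ε, TypeBFock.weightB α q J x p =
        ∑ π ∈ TypeBFock.pairPartitionsComp ε, TypeBFock.weight α q J x π) ∧
    TypeBFock.fockInner α q J (TypeBFock.vacuum H)
        ((List.ofFn (fun i => TypeBFock.gaussian α q J (x i))).reverse.prod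
          (TypeBFock.vacuum H)) =
      TypeBFock.fockInner α q J (TypeBFock.vacuum H)
        ((List.ofFn (fun i => TypeBFock.gaussian α q J (x i))).prod (TypeBFock.vacuum H)) ∧
    TypeBFock.fockInner α q J (TypeBFock.vacuum H)
        ((List.ofFn (fun i => TypeBFock.gaussian α q J (x i))).prod (TypeBFock.vacuum H)) =
      ∑ p ∈ TypeBFock.pairPartitionsB n, TypeBFock.weightB α q J x p ∧
    ∑ p ∈ TypeBFock.pairPartitionsB n, TypeBFock.weightB α q J x p =
      ∑ π ∈ TypeBFock.pairPartitions n, TypeBFock.weight α q J x π := by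
  have hre : ∀ i j, inner ℂ (x j) (x i) = inner ℂ (x i) (x j) := fun i j => by
    rw [← inner_conj_symm, Complex.conj_eq_iff_im]
    exact hHR.inner_im _ (hx i) _ (hx j)
  have hrev : ∀ A : Fin n → Module.End ℂ (TypeBFock.Fock H),
      (List.ofFn A).reverse = (List.finRange n).reverse.map A := fun A => by
    rw [List.ofFn_eq_map, List.map_reverse]
  have hG : TypeBFock.fockInner α q J (TypeBFock.vacuum H)
      ((List.ofFn (fun i => TypeBFock.gaussian α q J (x i))).reverse.prod
        (TypeBFock.vacuum H)) = ∑ π ∈ TypeBFock.pairPartitions n, TypeBFock.weight α q J x π := by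
    rw [hrev]
    exact TypeBFock.wick_eq_sum_weight hJ_symm hre hx_bar _
      fun i g => TypeBFock.inRadical_gaussian_sub (x i) g
  have hG' : TypeBFock.fockInner α q J (TypeBFock.vacuum H)
      ((List.ofFn (fun i => TypeBFock.gaussian α q J (x i))).prod (TypeBFock.vacuum H)) =
      ∑ π ∈ TypeBFock.pairPartitions n, TypeBFock.weight α q J x π := by
    -- Moving all letters to the left argument reverses the word; Hermitian symmetry then gives the
    -- conjugate of `hG`, a sum of real weights.
    rw [List.ofFn_eq_map, TypeBFock.fockInner_word_reverse _
      fun i => TypeBFock.fockInner_gaussian hJ_symm (x i), ← hrev,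
      ← TypeBFock.fockInner_conj α q J hJ_symm, hG, map_sum]
    exact Finset.sum_congr rfl fun π _ => TypeBFock.conj_weight hre hJ_symm hx_bar π
  refine ⟨fun ε => ⟨?_, TypeBFock.sum_weightB_pairPartitionsBComp α q J x ε⟩, hG.trans hG'.symm,
    hG'.trans (TypeBFock.sum_weightB_pairPartitionsB α q J x).symm,
    TypeBFock.sum_weightB_pairPartitionsB α q J x⟩
  rw [hrev, TypeBFock.sum_weightB_pairPartitionsBComp]
  exact TypeBFock.wick_eq_sum_weight_comp hJ_symm hre hx_bar ε
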